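/- Say that a function $f$ is of exponential type less than $\tau$ if it is analytic on $\{x\in\mathbb C:\operatorname{Re}x>0\}$ and there are $c\in[0,1)$, $\alpha<\tau$ and $K>0$ with $|f(x)|\le Ke^{\alpha|x|}$ whenever $\operatorname{Re}x>c$. If $a$ is of exponential type less than $\pi$, there is exactly one function $R_a$ of exponential type less than $2\pi$ with $R_a(x)-R_a(x+1)=a(x)$ for $\operatorname{Re}x>0$ and $\int_1^2R_a(t)\,dt=0$; the Ramanujan sum of the series $\sum_{n\ge1}a(n)$ is $\sum_{n\ge1}^{\mathcal R}a(n):=R_a(1)$, and it depends only on the values $a(n)$, $n\ge1$. Let $H_n=\sum_{j=1}^n1/j$ (with $H_0=0$), let $\gamma$ be Euler's constant, and let $B_n$ be the Bernoulli numbers, $\frac{z}{e^z-1}=\sum_{n\ge0}B_n\frac{z^n}{n!}$. **Theorem.** For every complex $z$ with $|z|<\pi$ the Ramanujan sums $\sum_{n\ge1}^{\mathcal R}e^{nz}\log n$ and $\sum_{n\ge1}^{\mathcal R}e^{-nz}H_n$ exist, and $$\sum_{n\ge1}^{\mathcal R}e^{nz}\log n+e^z\sum_{n\ge1}^{\mathcal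 R}e^{-nz}H_n=\gamma\left(\frac{e^z}{1-e^{-z}}-\frac1z\right)\quad\text{modulo }\mathbb Q[[z]],$$ that is, there is a power series $q=\sum_{k\ge0}q_kz^k$ with rational coefficients such that for all $|z|<\pi$ the series $\sum_k q_kz^k$ converges to the left-hand side minus $\gamma\left(\frac{e^z}{1-e^{-z}}-\frac1z\right)$ (where the bracket is given its limit $3/2$ at $z=0$). Explicitly, for $0<|z|<\pi$, $$\begin{aligned}\sum_{n\ge1}^{\mathcal R}e^{nz}\log n+e^z\sum_{n\ge1}^{\mathcal R}e^{-nz}H_n={}&\gamma\left(\frac{e^z}{1-e^{-z}}-\frac1z\right)+\sum_{k=1}^\infty\frac{z^kH_k}{k!}\cdot\frac{1-B_{k+1}}{k+1}\\&+\sum_{k=1}^\infty z^k\sum_{m=1}^{k+1}\frac{B_m}{m!}\,\frac{H_{k-m+1}}{(k-m+1)!}\\&+\frac{e^z}{1-e^{-z}}\log\left(\frac{z}{1-e^{-z}}\right)+\frac{e^z}{1-e^{-z}}\sum_{n=1}^\infty\frac{(-1)^n}{n}\frac{z^n}{n!},\end{aligned}$$ where all the series converge and $\log$ is the principal branch. 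-/

import Mathlib

noncomputable section

namespace RamanujanSummation

/-- `f` is holomorphic on the half-plane `Re x > 0` and of exponential type less than `τ` there:
`|f x| ≤ K * exp (α |x|)` for some `α < τ`. The bound is asked for on `Re x > c` for some `c < 1`,
so that functions such as `log x` and `1 / x`, which are unbounded near the boundary point `0`,
are covered. -/
def ExpTypeLT (τ : ℝ) (f : ℂ → ℂ) : Prop :=
  DifferentiableOn ℂ f {x : ℂ | 0 < x.re} ∧
    ∃ c : ℝ, 0 ≤ c ∧ c < 1 ∧ ∃ α : ℝ, α < τ ∧ ∃ K : ℝ, 0 < K ∧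
      ∀ x : ℂ, c < x.re → ‖f x‖ ≤ K * Real.exp (α * ‖x‖)

/-- `R` is the solution `R_a` of the difference equation `R x - R (x + 1) = a x` on the half-plane
`Re x > 0`, of exponential type less than `2π`, normalised by `∫₁² R = 0`. -/
def IsRemainder (a R : ℂ → ℂ) : Prop :=
  ExpTypeLT (2 * Real.pi) R ∧
    (∀ x : ℂ, 0 < x.re → R x - R (x + 1) = a x) ∧
    ∫ t in (1 : ℝ)..2, R (t : ℂ) = 0

/-- The series `∑_{n ≥ 1} u n` has Ramanujan sum `S`: the terms are the values `a n` of a function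
`a` of exponential type less than `π` on `Re x > 0`, and `S = R_a 1`. -/
def HasRamanujanSum (u : ℕ → ℂ) (S : ℂ) : Prop :=
  ∃ a R : ℂ → ℂ, ExpTypeLT Real.pi a ∧ (∀ n : ℕ, 1 ≤ n → a (n : ℂ) = u n) ∧
    IsRemainder a R ∧ R 1 = S

/-- The series `∑_{n ≥ 1} u n` is summable in the sense of Ramanujan. -/
def RamanujanSummable (u : ℕ → ℂ) : Prop := ∃ S : ℂ, HasRamanujanSum u S

open Classical in
/-- The Ramanujan sum of `∑_{n ≥ 1} u n` (with value `0` if there is none). -/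
def ramanujanSum (u : ℕ → ℂ) : ℂ :=
  if h : RamanujanSummable u then Classical.choose h else 0

/-- The terms `e^{nz} log n`. -/
def logTerm (z : ℂ) (n : ℕ) : ℂ := Complex.exp (n * z) * (Real.log n : ℂ)

/-- The terms `e^{-nz} H_n`. -/
def harmonicTerm (z : ℂ) (n : ℕ) : ℂ := Complex.exp (-(n * z)) * (harmonic n : ℂ)

/-- The function `e^z / (1 - e^{-z}) - 1 / z`, with its removable singularity at `0` filled in
by the limit `3 / 2`. -/
def gammaFactor (z : ℂ) : ℂ :=
  if z = 0 then 3 / 2 else Complex.exp z / (1 - Complex.exp (-z)) - 1 / z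

/-- The coefficients `(H_k / k!) (1 - B_{k+1}) / (k + 1)`. -/
def coeffA (k : ℕ) : ℚ :=
  harmonic k / (k.factorial : ℚ) * ((1 - bernoulli (k + 1)) / (k + 1))

/-- The coefficients `∑_{m=1}^{k+1} (B_m / m!) H_{k-m+1} / (k-m+1)!`. -/
def coeffB (k : ℕ) : ℚ :=
  ∑ m ∈ Finset.Icc 1 (k + 1),
    bernoulli m / (m.factorial : ℚ) * (harmonic (k + 1 - m) / ((k + 1 - m).factorial : ℚ))

/-- The coefficients `(-1)^n / (n * n!)`, used for `n ≥ 1`. -/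
def coeffC (n : ℕ) : ℚ :=
  (-1) ^ n / ((n : ℚ) * (n.factorial : ℚ))

end RamanujanSummation

end

/-!
Everything is made explicit in terms of the digamma function `ψ`, here in the guise
`harmonicPred x = ψ x + γ`, so that no analytic continuation in `z` and no limiting procedure is
needed: at each `z` with `‖z‖ < π` the remainders are written down and their values at `1` compared.

The remainder of `e ^ (x z) / x` is `V_z = -ψ + E_z` (`invRemainder`). Here `E_z` (`entirePart`) is
elementary, the integral over `0 ≤ s ≤ 1` of `z φ(x, s z)` with
`φ(x, w) = e ^ (x w) / (1 - e ^ w) + e ^ w / w` (`genKernel`), and has type `‖z‖` in `x`. Two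
operations then lead to the two sums of the theorem.

* Integration: if `R` is the remainder of `e ^ (x z) log x`, then `R' - z R` solves the difference
  equation of `e ^ (x z) / x` and has mean value zero on `[1, 2]`, so it is `V_z`. Conversely
  `R x = e ^ (x z) (C + G x)` with `G' = e ^ (-x z) V_z`, and for `z ≠ 0` the condition `R 1 = R 2`
  determines `C`; this gives `∑ e ^ (n z) log n = -e ^ z / (1 - e ^ (-z)) ∫₁² e ^ (-x z) V_z(x) dx`
  (`hasRamanujanSum_logTerm`).
* Summation by parts: `(1 - e ^ (-z))⁻¹ (e ^ (-x z) (ψ x + γ) + V_{-z} x)` is, up to a constant, the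
  remainder of `e ^ (-x z) H_x` (`hasRamanujanSum_harmonicTerm`).

In the combination of the theorem the integrals `∫₁² e ^ (-x z) ψ(x) dx`, which carry all the values
of `ζ'`, cancel (`ramanujanSum_add_eq`). What remains is `γ` times the bracket, the number
`E_{-z} 1`, which is the logarithm plus the last series (`entirePart_neg_one_eq_log`), and
`∫₁² e ^ (-x z) E_z(x) dx`, which yields the first two series because
`∑ c_n H_n z ^ n = ∫₀¹ (f z - f (s z)) / (1 - s) ds` for `f = ∑ c_n z ^ n` (`HasExpansion.harmonic`,
`sum_coeffA_coeffB_eq`).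

That the Ramanujan sum depends only on the terms, so that it may be computed from any remainder,
rests on two uniqueness theorems. Carlson's theorem (`ExpTypeLT.eq_zero_of_natCast_eq_zero`) follows
by dividing by `cos (π w)` and iterating the Phragmén-Lindelöf principle (`exp_decay_step`). A
`1`-periodic function of exponential type less than `2π` is constant, by its Fourier coefficients
(`eq_zero_of_periodic`).
-/

namespace RamanujanSummation

open Complex Set Filter Topology

/-! ### Carlson's theorem -/

theorem norm_exp_affine (p q : ℝ) (z : ℂ) :
    ‖Complex.exp ((p + q * I) * z)‖ = Real.exp (p * z.re - q * z.im) := by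
  rw [Complex.norm_exp]; simp

theorem mul_le_abs_mul (a : ℝ) {b n : ℝ} (h : |b| ≤ n) : a * b ≤ |a| * n :=
  (le_abs_self _).trans (by rw [abs_mul]; gcongr)

theorem isBigO_exp_norm {f : ℂ → ℂ} {s : Set ℂ} {C B : ℝ}
    (h : ∀ z ∈ s, ‖f z‖ ≤ C * Real.exp (B * ‖z‖)) :
    ∃ c < (2 : ℝ), ∃ B,
      f =O[Bornology.cobounded ℂ ⊓ 𝓟 s] fun z => Real.exp (B * ‖z‖ ^ c) := by
  refine ⟨1, by norm_num, B, Asymptotics.IsBigO.of_bound C ?_⟩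
  refine eventually_inf_principal.2 (Eventually.of_forall fun z hz => ?_)
  simpa [abs_of_pos (Real.exp_pos _)] using h z hz

/-- The Phragmén-Lindelöf step in Carlson's theorem: decay `e ^ (-δ |Im z|)` on the imaginary axis
lowers the exponential rate `H` along the real axis by `δ`. On the rays `arg z = ±π / 4`, where
`|Im z| = Re z`, the rate is `H - δ` by hypothesis, so the principle in the sector between them gives
the rate `H - δ` on the positive axis; the principle in the two quadrants then spreads this bound. The
constant `C` does not change, so that the step can be iterated. -/
theorem exp_decay_step {g : ℂ → ℂ} {C H δ : ℝ}
    (hg : DifferentiableOn ℂ g {z | 0 ≤ z.re})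
    (hb : ∀ z : ℂ, 0 ≤ z.re → ‖g z‖ ≤ C * Real.exp (H * z.re - δ * |z.im|)) :
    ∀ z : ℂ, 0 ≤ z.re → ‖g z‖ ≤ C * Real.exp ((H - δ) * z.re - δ * |z.im|) := by
  have hC : 0 ≤ C := by
    have := (norm_nonneg _).trans (hb 0 (by simp))
    simpa using this
  have hgrow : ∀ z : ℂ, 0 ≤ z.re → ‖g z‖ ≤ C * Real.exp ((|H| + |δ|) * ‖z‖) := by
    intro z hz
    refine (hb z hz).trans (mul_le_mul_of_nonneg_left (Real.exp_le_exp.2 ?_) hC)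
    have h1 : H * z.re ≤ |H| * ‖z‖ := mul_le_abs_mul _ (Complex.abs_re_le_norm z)
    have h2 : -δ * |z.im| ≤ |(-δ)| * ‖z‖ :=
      mul_le_abs_mul _ (by rw [abs_abs]; exact Complex.abs_im_le_norm z)
    rw [abs_neg] at h2
    linarith
  have hgrow2 : ∀ (p q : ℝ) (z : ℂ), 0 ≤ z.re →
      ‖g z * Complex.exp ((p + q * I) * z)‖
        ≤ C * Real.exp ((|H| + |δ| + (|p| + |q|)) * ‖z‖) := by
    intro p q z hz
    rw [norm_mul, add_mul _ (|p| + |q|), Real.exp_add, ← mul_assoc]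
    refine mul_le_mul (hgrow z hz) ?_ (norm_nonneg _) (by positivity)
    rw [norm_exp_affine]
    apply Real.exp_le_exp.2
    have h1 : p * z.re ≤ |p| * ‖z‖ := mul_le_abs_mul _ (Complex.abs_re_le_norm z)
    have h2 : -q * z.im ≤ |(-q)| * ‖z‖ := mul_le_abs_mul _ (Complex.abs_im_le_norm z)
    rw [abs_neg] at h2
    linarith
  have hcl1 : ∀ {t : Set ℝ}, closure (Ioi 0 ×ℂ t) ⊆ {z : ℂ | 0 ≤ z.re} := by
    intro t
    rw [Complex.closure_reProdIm]
    intro z hz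
    simpa using (mem_reProdIm.1 hz).1
  -- the quarter plane between the rays `arg z = ± π / 4`
  have hreal : ∀ x : ℝ, 0 ≤ x → ‖g x‖ ≤ C * Real.exp ((H - δ) * x) := by
    intro x hx
    have hmaps : ∀ w ∈ closure (Ioi (0:ℝ) ×ℂ Ioi (0:ℝ)), 0 ≤ ((1 - I) * w).re := by
      intro w hw
      rw [Complex.closure_reProdIm] at hw
      have h1 := (mem_reProdIm.1 hw).1
      have h2 := (mem_reProdIm.1 hw).2
      simp only [closure_Ioi, mem_Ici] at h1 h2
      simp; linarith
    have hray : ∀ z : ℂ, 0 ≤ z.re → |z.im| = z.re →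
        ‖g z * Complex.exp (((-(H - δ) : ℝ) + (0 : ℝ) * I) * z)‖ ≤ C := by
      intro z hz him
      rw [norm_mul, norm_exp_affine]
      have := hb z hz
      rw [him] at this
      calc _ ≤ C * Real.exp (H * z.re - δ * z.re) * Real.exp (-(H - δ) * z.re - 0 * z.im) := by
            gcongr
        _ = C := by rw [mul_assoc, ← Real.exp_add]; ring_nf; simp
    have key := PhragmenLindelof.quadrant_I (C := C)
      (f := fun w => g ((1 - I) * w) *
        Complex.exp (((-(H - δ) : ℝ) + (0 : ℝ) * I) * ((1 - I) * w))) (z := x * (1 + I) / 2)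
      (by
        apply DifferentiableOn.diffContOnCl
        apply DifferentiableOn.mul
        · exact hg.comp (by fun_prop) hmaps
        · fun_prop)
      (by
        refine isBigO_exp_norm (C := C)
          (B := (|H| + |δ| + (|(-(H - δ))| + |(0:ℝ)|)) * ‖(1 - I)‖) fun w hw => ?_
        refine (hgrow2 (-(H - δ)) 0 ((1 - I) * w) (hmaps w (subset_closure hw))).trans_eq ?_
        rw [norm_mul, mul_assoc])
      (by
        intro a ha
        apply hray
        · simpa using ha
        · simp [abs_of_nonneg ha])
      (by
        intro a ha
        apply hray
        · simpa using ha
        · simp [abs_of_nonneg ha])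
      (by simp; linarith) (by simp; linarith)
    have he : (1 - I) * (x * (1 + I) / 2) = (x : ℂ) := by
      linear_combination (-(x:ℂ) / 2) * I_sq
    simp only [he] at key
    rw [norm_mul, norm_exp_affine] at key
    calc ‖g x‖ = ‖g x‖ * Real.exp (-(H - δ) * (x:ℂ).re - 0 * (x:ℂ).im) * Real.exp ((H - δ) * x) := by
          rw [mul_assoc, ← Real.exp_add, ofReal_re, ofReal_im]; ring_nf; simp
      _ ≤ _ := by gcongr
  intro z hz
  have hbd_re : ∀ (q x : ℝ), 0 ≤ x →
      ‖g x * Complex.exp (((-(H - δ) : ℝ) + (-q : ℝ) * I) * x)‖ ≤ C := by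
    intro q x hx
    rw [norm_mul, norm_exp_affine]
    calc _ ≤ C * Real.exp ((H - δ) * x) * Real.exp (-(H - δ) * (x:ℂ).re - -q * (x:ℂ).im) := by
          gcongr; exact hreal x hx
      _ = C := by rw [mul_assoc, ← Real.exp_add, ofReal_re, ofReal_im]; ring_nf; simp
  have hbd_im : ∀ (q y : ℝ), δ * |y| = q * y →
      ‖g (y * I) * Complex.exp (((-(H - δ) : ℝ) + (-q : ℝ) * I) * (y * I))‖ ≤ C := by
    intro q y hy
    rw [norm_mul, norm_exp_affine]
    have := hb (y * I) (by simp)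
    calc _ ≤ C * Real.exp (H * (y * I : ℂ).re - δ * |(y * I : ℂ).im|) *
              Real.exp (-(H - δ) * (y * I : ℂ).re - -q * (y * I : ℂ).im) := by
          gcongr
      _ = C := by rw [mul_assoc, ← Real.exp_add]; simp [hy]
  have hdiff : ∀ (q : ℝ) (t : Set ℝ), DiffContOnCl ℂ
      (fun z => g z * Complex.exp (((-(H - δ) : ℝ) + (-q : ℝ) * I) * z)) (Ioi 0 ×ℂ t) := by
    intro q t
    apply DifferentiableOn.diffContOnCl
    exact (hg.mono hcl1).mul (by fun_prop)
  have hO : ∀ (q : ℝ) (t : Set ℝ), ∃ c < (2 : ℝ), ∃ B,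
      (fun z => g z * Complex.exp (((-(H - δ) : ℝ) + (-q : ℝ) * I) * z))
        =O[Bornology.cobounded ℂ ⊓ 𝓟 (Ioi 0 ×ℂ t)] fun z => Real.exp (B * ‖z‖ ^ c) :=
    fun q t => isBigO_exp_norm fun w hw => hgrow2 _ _ w (le_of_lt (mem_reProdIm.1 hw).1)
  rcases le_total 0 z.im with h | h
  · have key := PhragmenLindelof.quadrant_I (hdiff δ _) (hO δ _)
      (hbd_re δ) (fun y hy => hbd_im δ y (by rw [abs_of_nonneg hy])) hz h
    rw [norm_mul, norm_exp_affine] at key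
    rw [abs_of_nonneg h]
    calc ‖g z‖ = ‖g z‖ * Real.exp (-(H - δ) * z.re - -δ * z.im) *
            Real.exp ((H - δ) * z.re - δ * z.im) := by
          rw [mul_assoc, ← Real.exp_add]; ring_nf; simp
      _ ≤ _ := by gcongr
  · have key := PhragmenLindelof.quadrant_IV (hdiff (-δ) _) (hO (-δ) _)
      (hbd_re (-δ)) (fun y hy => hbd_im (-δ) y (by rw [abs_of_nonpos hy]; ring)) hz h
    rw [norm_mul, norm_exp_affine] at key
    rw [abs_of_nonpos h]
    calc ‖g z‖ = ‖g z‖ * Real.exp (-(H - δ) * z.re - - -δ * z.im) *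
            Real.exp ((H - δ) * z.re - δ * -z.im) := by
          rw [mul_assoc, ← Real.exp_add]; ring_nf; simp
      _ ≤ _ := by gcongr

/-- Iterating the previous step, the rate along the real axis tends to `-∞`. -/
theorem eq_zero_of_exp_decay {g : ℂ → ℂ} {C H δ : ℝ} (hδ : 0 < δ)
    (hg : DifferentiableOn ℂ g {z | 0 ≤ z.re})
    (hb : ∀ z : ℂ, 0 ≤ z.re → ‖g z‖ ≤ C * Real.exp (H * z.re - δ * |z.im|))
    {z : ℂ} (hz : 0 < z.re) : g z = 0 := by
  have hn : ∀ n : ℕ, ∀ z : ℂ, 0 ≤ z.re →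
      ‖g z‖ ≤ C * Real.exp ((H - n * δ) * z.re - δ * |z.im|) := by
    intro n
    induction n with
    | zero => simpa using hb
    | succ n ih =>
      intro z hz
      have := exp_decay_step hg ih z hz
      convert this using 4
      push_cast; ring
  have hlim : Tendsto (fun n : ℕ => C * Real.exp ((H - n * δ) * z.re - δ * |z.im|)) atTop (𝓝 0) := by
    rw [← mul_zero C]
    refine Tendsto.const_mul _ (Real.tendsto_exp_atBot.comp ?_)
    have h1 : Tendsto (fun n : ℕ => (n : ℝ) * (δ * z.re)) atTop atTop :=
      tendsto_natCast_atTop_atTop.atTop_mul_const (by positivity)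
    have h2 := tendsto_atBot_add_const_left atTop (H * z.re - δ * |z.im|)
      (tendsto_neg_atTop_atBot.comp h1)
    refine h2.congr fun n => ?_
    simp only [Function.comp]; ring
  have := ge_of_tendsto hlim (Eventually.of_forall fun n => hn n z hz.le)
  simpa using this

/-- The quotient `F / c` with its removable singularities filled in. -/
noncomputable def removableQuotient (F c : ℂ → ℂ) (w : ℂ) : ℂ :=
  open Classical in if c w = 0 then deriv F w / deriv c w else F w / c w

theorem differentiableOn_removableQuotient {F c : ℂ → ℂ} {U : Set ℂ} (hU : IsOpen U)
    (hF : DifferentiableOn ℂ F U) (hc : DifferentiableOn ℂ c U)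
    (h0 : ∀ w ∈ U, c w = 0 → F w = 0 ∧ deriv c w ≠ 0) :
    DifferentiableOn ℂ (removableQuotient F c) U := by
  intro w hw
  refine DifferentiableAt.differentiableWithinAt ?_
  have hUw : U ∈ 𝓝 w := hU.mem_nhds hw
  by_cases hcw : c w = 0
  · obtain ⟨hFw, hc'⟩ := h0 w hw hcw
    have d1 := ((Complex.differentiableOn_dslope hUw).2 hF).differentiableAt hUw
    have d2 := ((Complex.differentiableOn_dslope hUw).2 hc).differentiableAt hUw
    have hne : dslope c w w ≠ 0 := by rwa [dslope_same]
    refine (d1.div d2 hne).congr_of_eventuallyEq ?_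
    filter_upwards [d2.continuousAt.eventually_ne hne] with v hv
    by_cases hvw : v = w
    · subst hvw
      simp [removableQuotient, hcw]
    · have e1 := sub_smul_dslope F w v
      have e2 := sub_smul_dslope c w v
      rw [hFw, sub_zero, smul_eq_mul] at e1
      rw [hcw, sub_zero, smul_eq_mul] at e2
      have hs : v - w ≠ 0 := sub_ne_zero.2 hvw
      have hcv : c v ≠ 0 := by rw [← e2]; exact mul_ne_zero hs hv
      simp only [removableQuotient, hcv, if_false, Pi.div_apply]
      rw [← e1, ← e2, mul_div_mul_left _ _ hs]
  · have hcont := ((hc w hw).differentiableAt hUw).continuousAt.eventually_ne hcw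
    refine (((hF w hw).differentiableAt hUw).div ((hc w hw).differentiableAt hUw)
      hcw).congr_of_eventuallyEq ?_
    filter_upwards [hcont] with v hv
    simp [removableQuotient, hv]

/-- Together with the same bound on the lines `Re w = m`, this bounds `cos (π w)` from below on the
boundary of the rectangles `[m, m + 1] × [-1, 1]`, each of which has its zero in the interior. -/
theorem exp_le_norm_cos_of_one_le_abs_im {w : ℂ} (hw : 1 ≤ |w.im|) :
    Real.exp (Real.pi * |w.im|) / 4 ≤ ‖Complex.cos (Real.pi * w)‖ := by
  have h2 : (2 : ℝ) ≤ Real.exp (Real.pi * |w.im|) := by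
    have := Real.add_one_le_exp (Real.pi * |w.im|)
    nlinarith [Real.pi_gt_three]
  have h3 : Real.exp (-(Real.pi * |w.im|)) ≤ 1 := by
    rw [Real.exp_le_one_iff]; nlinarith [Real.pi_gt_three]
  have n1 : ‖Complex.exp (Real.pi * w * I)‖ = Real.exp (-(Real.pi * w.im)) := by
    rw [Complex.norm_exp]; simp
  have n2 : ‖Complex.exp (-(Real.pi * w) * I)‖ = Real.exp (Real.pi * w.im) := by
    rw [Complex.norm_exp]; simp
  have hcos : ‖Complex.cos (Real.pi * w)‖ =
      ‖Complex.exp (Real.pi * w * I) + Complex.exp (-(Real.pi * w) * I)‖ / 2 := by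
    rw [Complex.cos, norm_div]; simp
  rw [hcos]
  rcases le_total 0 w.im with h | h
  · rw [abs_of_nonneg h] at *
    have := norm_sub_le_norm_add (Complex.exp (-(Real.pi * w) * I)) (Complex.exp (Real.pi * w * I))
    rw [n1, n2, add_comm] at this
    linarith
  · rw [abs_of_nonpos h] at *
    have := norm_sub_le_norm_add (Complex.exp (Real.pi * w * I)) (Complex.exp (-(Real.pi * w) * I))
    rw [n1, n2] at this
    rw [mul_neg, neg_neg] at h3
    rw [mul_neg] at *
    linarith

theorem exp_le_norm_cos_of_re_eq_natCast {w : ℂ} {m : ℕ} (hw : w.re = m) :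
    Real.exp (Real.pi * |w.im|) / 4 ≤ ‖Complex.cos (Real.pi * w)‖ := by
  have hw' : w = m + w.im * I := by
    apply Complex.ext <;> simp [hw]
  have h1 : Complex.cos (Real.pi * w) = Complex.cos (m * Real.pi) * Real.cosh (Real.pi * w.im) := by
    conv_lhs => rw [hw']
    rw [mul_add, ← mul_assoc, Complex.cos_add, Complex.cos_mul_I, mul_comm (Real.pi : ℂ) m,
      Complex.sin_nat_mul_pi]
    push_cast; simp
  have h2 : ‖Complex.cos (m * Real.pi)‖ = 1 := by
    have : Complex.cos (m * Real.pi) = ((Real.cos (m * Real.pi) : ℝ) : ℂ) := by push_cast; rfl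
    rw [this, Complex.norm_real, Real.cos_nat_mul_pi]; simp
  rw [h1, norm_mul, h2, one_mul, Complex.norm_real, Real.norm_eq_abs,
    abs_of_pos (Real.cosh_pos _), ← Real.cosh_abs, abs_mul, abs_of_pos Real.pi_pos, Real.cosh_eq]
  have := Real.exp_pos (Real.pi * |w.im|)
  have := Real.exp_pos (-(Real.pi * |w.im|))
  linarith

/-- **Carlson's theorem**, in the form that a function on `Re w > -1` of exponential type less than
`π` that vanishes at the half-integers `-1/2, 1/2, 3/2, …` vanishes on the right half-plane. -/
theorem eq_zero_of_forall_cos_eq_zero {F : ℂ → ℂ} {K α : ℝ} (hα0 : 0 ≤ α) (hα : α < Real.pi)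
    (hF : DifferentiableOn ℂ F {w | -1 < w.re})
    (hb : ∀ w : ℂ, 0 ≤ w.re → ‖F w‖ ≤ K * Real.exp (α * ‖w‖))
    (h0 : ∀ w : ℂ, -1 < w.re → Complex.cos (Real.pi * w) = 0 → F w = 0)
    {w : ℂ} (hw : 0 < w.re) : F w = 0 := by
  have hK : 0 ≤ K := by
    have := (norm_nonneg _).trans (hb 0 (by simp))
    simpa using this
  set c : ℂ → ℂ := fun w => Complex.cos (Real.pi * w) with hcdef
  set G := removableQuotient F c with hG
  have hopen : IsOpen {w : ℂ | -1 < w.re} := isOpen_lt continuous_const Complex.continuous_re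
  have hGd : DifferentiableOn ℂ G {w | -1 < w.re} := by
    refine differentiableOn_removableQuotient hopen hF (by fun_prop) fun v hv hcv => ⟨h0 v hv hcv, ?_⟩
    have hd : HasDerivAt c (-Complex.sin (Real.pi * v) * (Real.pi * 1)) v :=
      ((hasDerivAt_id v).const_mul (Real.pi : ℂ)).ccos
    rw [hd.deriv]
    have hs : Complex.sin (Real.pi * v) ≠ 0 := by
      intro hs
      have := Complex.sin_sq_add_cos_sq (Real.pi * v)
      have hcv' : Complex.cos (Real.pi * v) = 0 := hcv
      rw [hs, hcv'] at this
      simp at this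
    simp [hs, Real.pi_ne_zero]
  -- the bound away from the zeros of the cosine
  have hfar : ∀ v : ℂ, 0 ≤ v.re → Real.exp (Real.pi * |v.im|) / 4 ≤ ‖c v‖ →
      ‖G v‖ ≤ 4 * K * Real.exp (α * ‖v‖ - Real.pi * |v.im|) := by
    intro v hv hcv
    have hpos := Real.exp_pos (Real.pi * |v.im|)
    have hcv0 : c v ≠ 0 := by
      intro h; rw [h, norm_zero] at hcv; linarith
    have : G v = F v / c v := by simp [hG, removableQuotient, hcv0]
    rw [this, norm_div, div_le_iff₀ (norm_pos_iff.2 hcv0)]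
    calc ‖F v‖ ≤ K * Real.exp (α * ‖v‖) := hb v hv
      _ = 4 * K * Real.exp (α * ‖v‖ - Real.pi * |v.im|) * (Real.exp (Real.pi * |v.im|) / 4) := by
        rw [Real.exp_sub]; field_simp
      _ ≤ _ := by gcongr
  have hall : ∀ v : ℂ, 0 ≤ v.re →
      ‖G v‖ ≤ 4 * K * Real.exp (4 * α + Real.pi) * Real.exp (α * ‖v‖ - Real.pi * |v.im|) := by
    intro v hv
    have hbig : 4 * K * Real.exp (α * ‖v‖ - Real.pi * |v.im|) ≤
        4 * K * Real.exp (4 * α + Real.pi) * Real.exp (α * ‖v‖ - Real.pi * |v.im|) := by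
      have : 1 ≤ Real.exp (4 * α + Real.pi) := Real.one_le_exp (by positivity)
      have h4 : 0 ≤ 4 * K := by positivity
      exact mul_le_mul_of_nonneg_right (le_mul_of_one_le_right h4 this) (Real.exp_pos _).le
    by_cases him : 1 ≤ |v.im|
    · exact (hfar v hv (exp_le_norm_cos_of_one_le_abs_im him)).trans hbig
    by_cases hfl : v.re = ⌊v.re⌋₊
    · exact (hfar v hv (exp_le_norm_cos_of_re_eq_natCast hfl)).trans hbig
    push Not at him
    set m := ⌊v.re⌋₊
    have hm1 : (m : ℝ) < v.re := lt_of_le_of_ne (Nat.floor_le hv) (Ne.symm hfl)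
    have hm2 : v.re < m + 1 := Nat.lt_floor_add_one _
    set U : Set ℂ := Ioo (m : ℝ) (m + 1) ×ℂ Ioo (-1 : ℝ) 1 with hU
    have hvU : v ∈ U := mem_reProdIm.2 ⟨⟨hm1, hm2⟩, abs_lt.1 him⟩
    have hcl : closure U = Icc (m : ℝ) (m + 1) ×ℂ Icc (-1 : ℝ) 1 := by
      rw [hU, Complex.closure_reProdIm, closure_Ioo (by linarith), closure_Ioo (by norm_num)]
    have hm0 : (0 : ℝ) ≤ m := Nat.cast_nonneg m
    have hnorm : ∀ u ∈ closure U, ‖u‖ ≤ ‖v‖ + 4 := by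
      intro u hu
      rw [hcl] at hu
      obtain ⟨⟨h1, h2⟩, h3, h4⟩ := mem_reProdIm.1 hu
      have a1 := Complex.norm_le_abs_re_add_abs_im (u - v)
      have a2 : |(u - v).re| ≤ 1 := by rw [sub_re, abs_le]; constructor <;> linarith
      have a3 : |(u - v).im| ≤ 2 := by
        rw [sub_im, abs_le]; constructor <;> linarith [(abs_lt.1 him).1, (abs_lt.1 him).2]
      have a4 := norm_sub_norm_le u v
      linarith
    have hbdd : Bornology.IsBounded U := by
      refine (Metric.isBounded_closedBall (x := (0:ℂ)) (r := ‖v‖ + 4)).subset fun u hu => ?_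
      simpa using hnorm u (subset_closure hu)
    have key := Complex.norm_le_of_forall_mem_frontier_norm_le (f := G) hbdd
      (C := 4 * K * Real.exp (α * (‖v‖ + 4))) (z := v)
      (by
        apply DifferentiableOn.diffContOnCl
        refine hGd.mono fun u hu => ?_
        rw [hcl] at hu
        have := (mem_reProdIm.1 hu).1.1
        simp only [mem_ofPred_eq]; linarith)
      (by
        intro u hu
        have huc := frontier_subset_closure hu
        have hun := hnorm u huc
        have huint : u ∉ U := by
          have hUo : IsOpen U := isOpen_Ioo.reProdIm isOpen_Ioo
          rw [hUo.frontier_eq] at hu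
          exact hu.2
        rw [hcl] at huc
        obtain ⟨⟨h1, h2⟩, h3, h4⟩ := mem_reProdIm.1 huc
        have hu0 : 0 ≤ u.re := by linarith
        have hc : Real.exp (Real.pi * |u.im|) / 4 ≤ ‖c u‖ := by
          by_cases e1 : u.re = m
          · exact exp_le_norm_cos_of_re_eq_natCast e1
          by_cases e2 : u.re = m + 1
          · exact exp_le_norm_cos_of_re_eq_natCast (m := m + 1) (by push_cast; exact e2)
          apply exp_le_norm_cos_of_one_le_abs_im
          by_contra hlt
          push Not at hlt
          exact huint (mem_reProdIm.2 ⟨⟨lt_of_le_of_ne h1 (Ne.symm e1), lt_of_le_of_ne h2 e2⟩,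
            abs_lt.1 hlt⟩)
        refine (hfar u hu0 hc).trans ?_
        have hpi : 0 ≤ Real.pi * |u.im| := by positivity
        have : α * ‖u‖ ≤ α * (‖v‖ + 4) := by gcongr
        gcongr
        linarith)
      (subset_closure hvU)
    refine key.trans ?_
    rw [mul_assoc (4 * K), ← Real.exp_add]
    have : Real.pi * |v.im| ≤ Real.pi := by nlinarith [Real.pi_pos]
    gcongr
    nlinarith
  have hdecay : ∀ v : ℂ, 0 ≤ v.re → ‖G v‖ ≤
      4 * K * Real.exp (4 * α + Real.pi) * Real.exp (α * v.re - (Real.pi - α) * |v.im|) := by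
    intro v hv
    refine (hall v hv).trans ?_
    have h1 := Complex.norm_le_abs_re_add_abs_im v
    rw [abs_of_nonneg hv] at h1
    refine mul_le_mul_of_nonneg_left (Real.exp_le_exp.2 ?_) (by positivity)
    nlinarith
  have hzero := eq_zero_of_exp_decay (by linarith : 0 < Real.pi - α)
    (hGd.mono fun v hv => by simp only [mem_ofPred_eq] at *; linarith) hdecay hw
  by_cases hcw : c w = 0
  · exact h0 w (by linarith) hcw
  · simp only [hG, removableQuotient, hcw, if_false, div_eq_zero_iff, or_false] at hzero
    exact hzero

/-- **Carlson's theorem**: a function of exponential type less than `π` on `Re x > 0` that vanishes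
at the positive integers vanishes identically. -/
theorem ExpTypeLT.eq_zero_of_natCast_eq_zero {f : ℂ → ℂ} (hf : ExpTypeLT Real.pi f)
    (h0 : ∀ n : ℕ, 1 ≤ n → f n = 0) {x : ℂ} (hx : 0 < x.re) : f x = 0 := by
  obtain ⟨hd, c, hc0, hc1, α, hα, K, hK, hb⟩ := hf
  have hopen : IsOpen {x : ℂ | 0 < x.re} := isOpen_lt continuous_const Complex.continuous_re
  have hfar : ∀ x : ℂ, 3 / 2 < x.re → f x = 0 := by
    intro x hx
    have := eq_zero_of_forall_cos_eq_zero (F := fun w => f (w + 3 / 2))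
      (K := K * Real.exp (max α 0 * (3 / 2))) (α := max α 0) (w := x - 3 / 2) (le_max_right _ _)
      (max_lt hα Real.pi_pos)
      (by
        refine hd.comp (by fun_prop) fun w hw => ?_
        simp only [mem_ofPred_eq, add_re] at *
        norm_num; linarith)
      (by
        intro w hw
        refine (hb (w + 3 / 2) (by simp; norm_num; linarith)).trans ?_
        rw [mul_assoc, ← Real.exp_add, ← mul_add]
        have h1 : ‖w + 3 / 2‖ ≤ 3 / 2 + ‖w‖ := by
          refine (norm_add_le _ _).trans ?_
          rw [add_comm]; gcongr; norm_num
        refine mul_le_mul_of_nonneg_left (Real.exp_le_exp.2 ?_) hK.le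
        calc α * ‖w + 3 / 2‖ ≤ max α 0 * ‖w + 3 / 2‖ := by gcongr; exact le_max_left _ _
          _ ≤ _ := by gcongr)
      (by
        intro w hw hcos
        rw [Complex.cos_eq_zero_iff] at hcos
        obtain ⟨k, hk⟩ := hcos
        have hpi : (Real.pi : ℂ) ≠ 0 := by exact_mod_cast Real.pi_ne_zero
        have hwk : w = k + 1 / 2 := by
          apply mul_left_cancel₀ hpi; rw [hk]; ring
        have hk1 : (-2 : ℤ) < k := by
          rw [hwk] at hw
          simp at hw
          have : (-2 : ℝ) < k := by norm_num at hw; linarith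
          exact_mod_cast this
        obtain ⟨n, hn⟩ : ∃ n : ℕ, k + 2 = n := ⟨(k + 2).toNat, by omega⟩
        have : w + 3 / 2 = (n : ℂ) := by
          rw [hwk]
          have : ((k + 2 : ℤ) : ℂ) = n := by exact_mod_cast congrArg (Int.cast (R := ℂ)) hn
          rw [← this]; push_cast; ring
        simp only [this]
        exact h0 n (by omega))
      (by simp; norm_num; linarith)
    simpa using this
  have han : AnalyticOnNhd ℂ f {x : ℂ | 0 < x.re} := hd.analyticOnNhd hopen
  refine han.eqOn_zero_of_preconnected_of_eventuallyEq_zero (z₀ := 2)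
    (convex_halfSpace_re_gt 0).isPreconnected (by simp) ?_ hx
  have h2 : {x : ℂ | 3 / 2 < x.re} ∈ 𝓝 (2 : ℂ) :=
    (isOpen_lt continuous_const Complex.continuous_re).mem_nhds (by simp; norm_num)
  filter_upwards [h2] with x hx
  exact hfar x hx

/-! ### Uniqueness of the Ramanujan sum -/

theorem isOpen_re_pos : IsOpen {x : ℂ | 0 < x.re} :=
  isOpen_lt continuous_const Complex.continuous_re

theorem ExpTypeLT.add {τ : ℝ} {f g : ℂ → ℂ} (hf : ExpTypeLT τ f) (hg : ExpTypeLT τ g) :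
    ExpTypeLT τ (fun x => f x + g x) := by
  obtain ⟨hfd, c, hc0, hc1, α, hα, K, hK, hb⟩ := hf
  obtain ⟨hgd, c', hc0', hc1', α', hα', K', hK', hb'⟩ := hg
  refine ⟨hfd.add hgd, max c c', le_max_of_le_left hc0, max_lt hc1 hc1', max α α', max_lt hα hα',
    K + K', by positivity, fun x hx => ?_⟩
  have h1 := hb x ((le_max_left _ _).trans_lt hx)
  have h2 := hb' x ((le_max_right _ _).trans_lt hx)
  refine (norm_add_le _ _).trans ?_
  rw [add_mul]
  refine add_le_add (h1.trans ?_) (h2.trans ?_) <;> gcongr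
  · exact le_max_left _ _
  · exact le_max_right _ _

theorem ExpTypeLT.const_mul {τ : ℝ} {f : ℂ → ℂ} (hf : ExpTypeLT τ f) (a : ℂ) :
    ExpTypeLT τ (fun x => a * f x) := by
  obtain ⟨hfd, c, hc0, hc1, α, hα, K, hK, hb⟩ := hf
  refine ⟨hfd.const_mul a, c, hc0, hc1, α, hα, (‖a‖ + 1) * K, by positivity, fun x hx => ?_⟩
  rw [norm_mul, mul_assoc]
  exact mul_le_mul (by linarith) (hb x hx) (norm_nonneg _) (by positivity)

theorem ExpTypeLT.sub {τ : ℝ} {f g : ℂ → ℂ} (hf : ExpTypeLT τ f) (hg : ExpTypeLT τ g) :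
    ExpTypeLT τ (fun x => f x - g x) := by
  simpa [sub_eq_add_neg] using hf.add (hg.const_mul (-1))

theorem continuousOn_ofReal_of_differentiableOn {p : ℂ → ℂ}
    (hp : DifferentiableOn ℂ p {x | 0 < x.re}) :
    ContinuousOn (fun t : ℝ => p t) (Ioi 0) :=
  hp.continuousOn.comp continuous_ofReal.continuousOn fun t ht => by simpa using ht

theorem intervalIntegrable_ofReal_of_differentiableOn {p : ℂ → ℂ}
    (hp : DifferentiableOn ℂ p {x | 0 < x.re}) :
    IntervalIntegrable (fun t : ℝ => p t) MeasureTheory.volume 1 2 := by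
  apply ContinuousOn.intervalIntegrable
  refine (continuousOn_ofReal_of_differentiableOn hp).mono fun t ht => ?_
  rw [uIcc_of_le (by norm_num)] at ht
  exact lt_of_lt_of_le one_pos ht.1

/-- The Fourier coefficient of a `1`-periodic holomorphic function can be computed on any horizontal
segment of length `1`. -/
theorem integral_periodic_eq_integral_shift {F : ℂ → ℂ}
    (hF : DifferentiableOn ℂ F {x | 0 < x.re}) (hper : ∀ x : ℂ, 0 < x.re → F (x + 1) = F x)
    (y : ℝ) : ∫ x in (1 : ℝ)..2, F x = ∫ x in (1 : ℝ)..2, F (x + y * I) := by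
  have key := Complex.integral_boundary_rect_eq_zero_of_differentiableOn F 1 (2 + y * I)
    (hF.mono fun x hx => by
      have h1 := (mem_reProdIm.1 hx).1
      simp only [one_re, add_re, re_ofNat, mul_re, ofReal_re, I_re, mul_zero, ofReal_im, I_im,
        mul_one, sub_self, add_zero] at h1
      rw [uIcc_of_le (by norm_num)] at h1
      exact lt_of_lt_of_le one_pos h1.1)
  have hside : ∀ t : ℝ, F (2 + t * I) = F (1 + t * I) := by
    intro t
    rw [← hper (1 + t * I) (by simp)]
    congr 1; ring
  simp only [one_re, one_im, add_re, re_ofNat, mul_re, ofReal_re, I_re, mul_zero, ofReal_im, I_im,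
    mul_one, sub_self, add_zero, add_im, im_ofNat, mul_im, zero_add, ofReal_zero, zero_mul,
    ofReal_ofNat, ofReal_one] at key
  simp only [hside, add_sub_cancel_right] at key
  exact sub_eq_zero.1 key

/-- A `1`-periodic function of exponential type less than `2π` has no nonconstant Fourier modes:
shifting the segment of integration to `Im x = ∓ t` multiplies the mode by `exp (-2π |n| t)`, which
beats the growth of the function. -/
theorem integral_mul_exp_eq_zero_of_periodic {p : ℂ → ℂ} (hp : ExpTypeLT (2 * Real.pi) p)
    (hper : ∀ x : ℂ, 0 < x.re → p (x + 1) = p x) {n : ℤ} (hn : n ≠ 0) :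
    ∫ x in (1 : ℝ)..2, Complex.exp (2 * Real.pi * I * n * x) * p x = 0 := by
  obtain ⟨hd, c, hc0, hc1, α', hα', K, hK, hb'⟩ := hp
  obtain ⟨α, hα0, hα, hb⟩ : ∃ α : ℝ, 0 ≤ α ∧ α < 2 * Real.pi ∧ ∀ x : ℂ, c < x.re →
      ‖p x‖ ≤ K * Real.exp (α * ‖x‖) := by
    refine ⟨max α' 0, le_max_right _ _, max_lt hα' (by positivity), fun x hx => ?_⟩
    refine (hb' x hx).trans ?_
    gcongr
    exact le_max_left _ _
  set F : ℂ → ℂ := fun x => Complex.exp (2 * Real.pi * I * n * x) * p x with hFdef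
  have hFd : DifferentiableOn ℂ F {x | 0 < x.re} := by
    apply DifferentiableOn.mul
    · fun_prop
    · exact hd
  have hFper : ∀ x : ℂ, 0 < x.re → F (x + 1) = F x := by
    intro x hx
    have : Complex.exp (2 * Real.pi * I * n * (x + 1)) = Complex.exp (2 * Real.pi * I * n * x) := by
      rw [mul_add, Complex.exp_add, mul_one,
        show 2 * (Real.pi : ℂ) * I * n = n * (2 * Real.pi * I) by ring,
        Complex.exp_int_mul_two_pi_mul_I, mul_one]
    simp only [hFdef, this, hper x hx]
  have hbound : ∀ t : ℝ, 0 ≤ t →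
      ‖∫ x in (1 : ℝ)..2, F x‖ ≤ K * Real.exp (α * 2) * Real.exp (-((2 * Real.pi - α) * t)) := by
    intro t ht
    obtain ⟨y, hy1, hy2⟩ : ∃ y : ℝ, |y| = t ∧ 2 * Real.pi * t ≤ 2 * Real.pi * n * y := by
      rcases lt_or_gt_of_ne hn with h | h
      · refine ⟨-t, by rw [abs_neg, abs_of_nonneg ht], ?_⟩
        have : (n : ℝ) ≤ -1 := by exact_mod_cast (by omega : n ≤ -1)
        have h2 : t ≤ n * -t := by nlinarith
        rw [mul_assoc (2 * Real.pi)]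
        exact mul_le_mul_of_nonneg_left h2 (by positivity)
      · refine ⟨t, abs_of_nonneg ht, ?_⟩
        have : (1 : ℝ) ≤ n := by exact_mod_cast (by omega : 1 ≤ n)
        have h2 : t ≤ n * t := by nlinarith
        rw [mul_assoc (2 * Real.pi)]
        exact mul_le_mul_of_nonneg_left h2 (by positivity)
    rw [integral_periodic_eq_integral_shift hFd hFper y]
    have := intervalIntegral.norm_integral_le_of_norm_le_const (a := (1:ℝ)) (b := 2)
      (f := fun x : ℝ => F (x + y * I))
      (C := K * Real.exp (α * 2) * Real.exp (-((2 * Real.pi - α) * t))) ?_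
    · simpa [show |(2:ℝ) - 1| = 1 by norm_num] using this
    intro x hx
    rw [uIoc_of_le (by norm_num)] at hx
    have hre : c < (x + y * I : ℂ).re := by simp; linarith [hx.1]
    have hnorm : ‖(x + y * I : ℂ)‖ ≤ 2 + t := by
      refine (Complex.norm_le_abs_re_add_abs_im _).trans ?_
      simp only [add_re, ofReal_re, mul_re, I_re, mul_zero, ofReal_im, I_im, mul_one, sub_self,
        add_zero, add_im, mul_im, zero_add, hy1]
      rw [abs_of_pos (by linarith [hx.1])]
      linarith [hx.2]
    simp only [hFdef]
    rw [norm_mul, Complex.norm_exp]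
    have he : (2 * Real.pi * I * n * (x + y * I) : ℂ).re = -(2 * Real.pi * n * y) := by
      simp
    rw [he]
    calc Real.exp (-(2 * Real.pi * n * y)) * ‖p (x + y * I)‖
        ≤ Real.exp (-(2 * Real.pi * t)) * (K * Real.exp (α * (2 + t))) := by
          refine mul_le_mul (Real.exp_le_exp.2 (by linarith)) ((hb _ hre).trans ?_)
            (norm_nonneg _) (Real.exp_pos _).le
          gcongr
      _ = _ := by
          rw [mul_left_comm, mul_assoc K, ← Real.exp_add, ← Real.exp_add]; ring_nf
  have hlim : Tendsto (fun t : ℝ => K * Real.exp (α * 2) * Real.exp (-((2 * Real.pi - α) * t)))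
      atTop (𝓝 0) := by
    rw [← mul_zero (K * Real.exp (α * 2))]
    refine Tendsto.const_mul _ (Real.tendsto_exp_atBot.comp ?_)
    exact tendsto_neg_atTop_atBot.comp (tendsto_id.const_mul_atTop (by linarith))
  have h0 := ge_of_tendsto hlim ((eventually_ge_atTop 0).mono fun t ht => hbound t ht)
  simpa using h0

/-- A `1`-periodic function of exponential type less than `2π` with mean value zero vanishes. -/
theorem eq_zero_of_periodic {p : ℂ → ℂ} (hp : ExpTypeLT (2 * Real.pi) p)
    (hper : ∀ x : ℂ, 0 < x.re → p (x + 1) = p x)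
    (hint : ∫ t in (1 : ℝ)..2, p t = 0) {x : ℂ} (hx : 0 < x.re) : p x = 0 := by
  have hd := hp.1
  have hcont : Continuous (AddCircle.liftIco (1 : ℝ) 1 (fun t : ℝ => p t)) := by
    apply AddCircle.liftIco_continuous
    · have := hper 1 (by simp)
      push_cast
      exact this.symm
    · refine (continuousOn_ofReal_of_differentiableOn hd).mono fun t ht => ?_
      exact lt_of_lt_of_le one_pos ht.1
  have hcoeff : ∀ n : ℤ, fourierCoeff (AddCircle.liftIco (1 : ℝ) 1 (fun t : ℝ => p t)) n = 0 := by
    intro n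
    rw [fourierCoeff_liftIco_eq, fourierCoeffOn_eq_integral]
    have h12 : (1 : ℝ) + 1 = 2 := by norm_num
    rw [h12]
    have : ∀ t : ℝ, (fourier (-n) : C(AddCircle ((2:ℝ) - 1), ℂ)) (t : AddCircle ((2:ℝ) - 1)) • p t
        = Complex.exp (2 * Real.pi * I * (-n : ℤ) * t) * p t := by
      intro t
      rw [fourier_coe_apply, smul_eq_mul]
      congr 2
      push_cast
      rw [show (2 : ℂ) - 1 = 1 by norm_num, div_one]
    simp only [this]
    by_cases hn : n = 0
    · subst hn
      simp [hint]
    · rw [integral_mul_exp_eq_zero_of_periodic hp hper (neg_ne_zero.2 hn), smul_zero]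
  set f : C(AddCircle (1 : ℝ), ℂ) := ⟨_, hcont⟩ with hf
  have hcoeff' : ∀ n : ℤ, fourierCoeff f n = 0 := hcoeff
  have hzero : ∀ t : ℝ, t ∈ Ico (1 : ℝ) (1 + 1) → p t = 0 := by
    intro t ht
    have hs : Summable (fourierCoeff f) := by
      rw [funext hcoeff']; exact summable_zero
    have := has_pointwise_sum_fourier_series_of_summable hs (t : AddCircle (1 : ℝ))
    simp only [hcoeff', zero_smul] at this
    have h2 := this.unique hasSum_zero
    rw [← h2, hf]
    exact (AddCircle.liftIco_coe_apply (p := (1:ℝ)) (f := fun t : ℝ => p t) ht).symm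
  have han : AnalyticOnNhd ℂ p {x : ℂ | 0 < x.re} := hd.analyticOnNhd isOpen_re_pos
  refine han.eqOn_zero_of_preconnected_of_frequently_eq_zero (z₀ := ((3 / 2 : ℝ) : ℂ))
    (convex_halfSpace_re_gt 0).isPreconnected (by simp) ?_ hx
  have hmap : Tendsto (fun t : ℝ => (t : ℂ)) (𝓝[≠] (3 / 2)) (𝓝[≠] ((3 / 2 : ℝ) : ℂ)) := by
    refine (continuous_ofReal.continuousAt (x := (3 / 2 : ℝ))).continuousWithinAt.tendsto_nhdsWithin ?_
    intro t ht
    simpa [← ofReal_inj] using ht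
  refine hmap.frequently (Eventually.frequently ?_)
  have : Ioo (1 : ℝ) 2 ∈ 𝓝[≠] (3 / 2 : ℝ) :=
    mem_nhdsWithin_of_mem_nhds (Ioo_mem_nhds (by norm_num) (by norm_num))
  filter_upwards [this] with t ht
  exact hzero t ⟨ht.1.le, by linarith [ht.2]⟩

theorem HasRamanujanSum.unique {u : ℕ → ℂ} {S S' : ℂ} (h : HasRamanujanSum u S)
    (h' : HasRamanujanSum u S') : S = S' := by
  obtain ⟨a, R, ha, hu, ⟨hR, hRe, hRi⟩, rfl⟩ := h
  obtain ⟨a', R', ha', hu', ⟨hR', hRe', hRi'⟩, rfl⟩ := h'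
  have haa : ∀ x : ℂ, 0 < x.re → a x = a' x := fun x hx =>
    sub_eq_zero.1 ((ha.sub ha').eq_zero_of_natCast_eq_zero
      (fun n hn => by simp only [hu n hn, hu' n hn, sub_self]) hx)
  refine sub_eq_zero.1 (eq_zero_of_periodic (p := fun x => R x - R' x) (hR.sub hR') ?_ ?_
    (x := 1) (by simp))
  · intro x hx
    have h1 := hRe x hx
    have h2 := hRe' x hx
    rw [haa x hx] at h1
    linear_combination h2 - h1
  · rw [intervalIntegral.integral_sub (intervalIntegrable_ofReal_of_differentiableOn hR.1)
      (intervalIntegrable_ofReal_of_differentiableOn hR'.1), hRi, hRi', sub_zero]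

theorem HasRamanujanSum.ramanujanSum_eq {u : ℕ → ℂ} {S : ℂ} (h : HasRamanujanSum u S) :
    ramanujanSum u = S := by
  have hs : RamanujanSummable u := ⟨S, h⟩
  rw [ramanujanSum, dif_pos hs]
  exact (Classical.choose_spec hs).unique h

/-! ### Expansions in power series -/

/-- `f` is the sum of the power series with coefficients `c` on the disc `‖z‖ < r`. -/
def HasExpansion (r : ℝ) (c : ℕ → ℂ) (f : ℂ → ℂ) : Prop :=
  ∀ z : ℂ, ‖z‖ < r → HasSum (fun n => c n * z ^ n) (f z)

theorem HasExpansion.summable_norm {r : ℝ} {c : ℕ → ℂ} {f : ℂ → ℂ} (h : HasExpansion r c f)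
    {z : ℂ} (hz : ‖z‖ < r) : Summable fun n => ‖c n * z ^ n‖ :=
  (h z hz).summable.norm

theorem HasExpansion.summable_nat_mul_norm {r : ℝ} {c : ℕ → ℂ} {f : ℂ → ℂ}
    (h : HasExpansion r c f) {z : ℂ} (hz : ‖z‖ < r) :
    Summable fun n : ℕ => (n : ℝ) * ‖c n * z ^ n‖ := by
  obtain ⟨ρ, hρ1, hρ2⟩ := exists_between hz
  have hρ : 0 < ρ := (norm_nonneg z).trans_lt hρ1
  have hs := h.summable_norm (z := (ρ : ℂ)) (by simpa [abs_of_pos hρ] using hρ2)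
  have ht := tendsto_self_mul_const_pow_of_lt_one (r := ‖z‖ / ρ) (by positivity)
    ((div_lt_one hρ).2 hρ1)
  obtain ⟨M, hM⟩ := ht.bddAbove_range
  refine Summable.of_nonneg_of_le (fun n => by positivity) (fun n => ?_) (hs.mul_left M)
  have hMn : (n : ℝ) * (‖z‖ / ρ) ^ n ≤ M := hM ⟨n, rfl⟩
  have hid : (n : ℝ) * ‖c n * z ^ n‖ = (n : ℝ) * (‖z‖ / ρ) ^ n * ‖c n * (ρ : ℂ) ^ n‖ := by
    simp only [norm_mul, norm_pow, Complex.norm_real, Real.norm_eq_abs, abs_of_pos hρ, div_pow]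
    field_simp
  rw [hid]
  gcongr

theorem HasExpansion.add {r : ℝ} {c d : ℕ → ℂ} {f g : ℂ → ℂ} (hf : HasExpansion r c f)
    (hg : HasExpansion r d g) : HasExpansion r (fun n => c n + d n) (fun z => f z + g z) := by
  intro z hz
  simpa [add_mul] using (hf z hz).add (hg z hz)

theorem HasExpansion.const_mul {r : ℝ} {c : ℕ → ℂ} {f : ℂ → ℂ} (hf : HasExpansion r c f) (a : ℂ) :
    HasExpansion r (fun n => a * c n) (fun z => a * f z) := by
  intro z hz
  simpa [mul_assoc] using (hf z hz).mul_left a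

theorem HasExpansion.sub {r : ℝ} {c d : ℕ → ℂ} {f g : ℂ → ℂ} (hf : HasExpansion r c f)
    (hg : HasExpansion r d g) : HasExpansion r (fun n => c n - d n) (fun z => f z - g z) := by
  intro z hz
  simpa [sub_mul] using (hf z hz).sub (hg z hz)

theorem HasExpansion.mul {r : ℝ} {c d : ℕ → ℂ} {f g : ℂ → ℂ} (hf : HasExpansion r c f)
    (hg : HasExpansion r d g) :
    HasExpansion r (fun n => ∑ p ∈ Finset.HasAntidiagonal.antidiagonal n, c p.1 * d p.2) (fun z => f z * g z) := by
  intro z hz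
  have h1 := hf.summable_norm hz
  have h2 := hg.summable_norm hz
  have hs := (summable_norm_sum_mul_antidiagonal_of_summable_norm h1 h2).of_norm.hasSum
  rw [← tsum_mul_tsum_eq_tsum_sum_antidiagonal_of_summable_norm h1 h2, (hf z hz).tsum_eq,
    (hg z hz).tsum_eq] at hs
  refine hs.congr_fun ?_
  intro n
  rw [Finset.sum_mul]
  refine Finset.sum_congr rfl fun p hp => ?_
  rw [← Finset.HasAntidiagonal.mem_antidiagonal.1 hp, pow_add]
  ring

theorem HasExpansion.comp_mul {r : ℝ} {c : ℕ → ℂ} {f : ℂ → ℂ} (hf : HasExpansion r c f) {a : ℂ}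
    (ha : ‖a‖ ≤ 1) : HasExpansion r (fun n => c n * a ^ n) (fun z => f (a * z)) := by
  intro z hz
  have := hf (a * z) (by
    rw [norm_mul]
    exact (mul_le_of_le_one_left (norm_nonneg z) ha).trans_lt hz)
  simpa [mul_pow, mul_assoc] using this

theorem HasExpansion.mono {r r' : ℝ} {c : ℕ → ℂ} {f : ℂ → ℂ} (hf : HasExpansion r c f)
    (h : r' ≤ r) : HasExpansion r' c f := fun z hz => hf z (hz.trans_le h)

theorem HasExpansion.apply_zero {r : ℝ} (hr : 0 < r) {c : ℕ → ℂ} {f : ℂ → ℂ}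
    (hf : HasExpansion r c f) : f 0 = c 0 := by
  have h := hf 0 (by simpa using hr)
  have h2 := hasSum_single (f := fun n => c n * (0:ℂ) ^ n) 0 (fun n hn => by simp [hn])
  rw [h.unique h2]; simp

theorem HasExpansion.deriv_zero {r : ℝ} (hr : 0 < r) {c : ℕ → ℂ} {f : ℂ → ℂ}
    (hf : HasExpansion r c f) : deriv f 0 = c 1 := by
  set p : FormalMultilinearSeries ℂ ℂ ℂ := fun n => ContinuousMultilinearMap.mkPiRing ℂ (Fin n) (c n)
  have hp : HasFPowerSeriesAt f p 0 := by
    rw [hasFPowerSeriesAt_iff]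
    filter_upwards [Metric.ball_mem_nhds (0 : ℂ) hr] with z hz
    have := hf z (by simpa using hz)
    simpa [p, FormalMultilinearSeries.coeff, mul_comm] using this
  rw [hp.deriv]
  simp [p]

/-- Removing the constant term and dividing by `z` shifts the coefficients. -/
theorem HasExpansion.dslope {r : ℝ} {c : ℕ → ℂ} {f : ℂ → ℂ}
    (hf : HasExpansion r c f) : HasExpansion r (fun n => c (n + 1)) (dslope f 0) := by
  intro z hz
  have hr : 0 < r := (norm_nonneg z).trans_lt hz
  by_cases h0 : z = 0
  · subst h0
    rw [dslope_same, hf.deriv_zero hr]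
    convert hasSum_single (f := fun n => c (n + 1) * (0:ℂ) ^ n) 0 (fun n hn => by simp [hn]) using 1
    simp
  · have h1 := (hasSum_nat_add_iff' 1).2 (hf z hz)
    simp only [Finset.range_one, Finset.sum_singleton, pow_zero, mul_one, ← hf.apply_zero hr] at h1
    have h2 := h1.mul_left z⁻¹
    rw [dslope_of_ne _ h0, slope_def_field, sub_zero, div_eq_inv_mul]
    refine h2.congr_fun fun n => ?_
    rw [pow_succ]; field_simp

/-- Averaging over the segment from `0` to `z` divides the `n`-th coefficient by `n + 1`. -/
theorem HasExpansion.integral {r : ℝ} {c : ℕ → ℂ} {f : ℂ → ℂ} (hf : HasExpansion r c f) :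
    HasExpansion r (fun n => c n / (n + 1)) (fun z => ∫ s in (0 : ℝ)..1, f (s * z)) := by
  intro z hz
  have hs := hf.summable_norm hz
  have key := intervalIntegral.hasSum_integral_of_dominated_convergence (a := (0:ℝ)) (b := 1)
    (μ := MeasureTheory.volume) (F := fun n (s : ℝ) => c n * (s * z) ^ n)
    (f := fun s : ℝ => f (s * z)) (fun n _ => ‖c n * z ^ n‖)
    (fun n => (by fun_prop : Continuous fun s : ℝ => c n * (s * z) ^ n).aestronglyMeasurable)
    (fun n => Eventually.of_forall fun s hs => by
      rw [uIoc_of_le zero_le_one] at hs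
      rw [mul_pow, mul_left_comm, norm_mul, norm_pow, Complex.norm_real, Real.norm_eq_abs,
        abs_of_pos hs.1]
      exact mul_le_of_le_one_left (norm_nonneg _) (pow_le_one₀ hs.1.le hs.2))
    (Eventually.of_forall fun s _ => hs) intervalIntegrable_const
    (Eventually.of_forall fun s hs => by
      rw [uIoc_of_le zero_le_one] at hs
      refine hf _ ?_
      rw [norm_mul, Complex.norm_real, Real.norm_eq_abs, abs_of_pos hs.1]
      exact (mul_le_of_le_one_left (norm_nonneg _) hs.2).trans_lt hz)
  refine key.congr_fun fun n => ?_
  have : ∀ s : ℝ, c n * (s * z) ^ n = c n * z ^ n * ((s ^ n : ℝ) : ℂ) := by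
    intro s; push_cast; ring
  simp only [this]
  rw [intervalIntegral.integral_const_mul, intervalIntegral.integral_ofReal, integral_pow]
  simp
  ring

/-- Multiplying the coefficients by harmonic numbers, through `H_n = ∫₀¹ (1 - s ^ n) / (1 - s) ds`. -/
theorem HasExpansion.harmonic {r : ℝ} {c : ℕ → ℂ} {f : ℂ → ℂ} (hf : HasExpansion r c f) :
    HasExpansion r (fun n => c n * (harmonic n : ℂ))
      (fun z => ∫ s in (0 : ℝ)..1, (f z - f (s * z)) / (1 - s)) := by
  intro z hz
  have hs := hf.summable_nat_mul_norm hz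
  have key := intervalIntegral.hasSum_integral_of_dominated_convergence (a := (0:ℝ)) (b := 1)
    (μ := MeasureTheory.volume)
    (F := fun n (s : ℝ) => c n * z ^ n * ∑ j ∈ Finset.range n, (s : ℂ) ^ j)
    (f := fun s : ℝ => (f z - f (s * z)) / (1 - s)) (fun n _ => n * ‖c n * z ^ n‖)
    (fun n => (by fun_prop : Continuous fun s : ℝ =>
      c n * z ^ n * ∑ j ∈ Finset.range n, (s : ℂ) ^ j).aestronglyMeasurable)
    (fun n => Eventually.of_forall fun s hs => by
      rw [uIoc_of_le zero_le_one] at hs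
      rw [norm_mul, mul_comm]
      refine mul_le_mul_of_nonneg_right ?_ (norm_nonneg _)
      refine (norm_sum_le _ _).trans ?_
      refine (Finset.sum_le_card_nsmul _ _ 1 fun j _ => ?_).trans (by simp)
      rw [norm_pow, Complex.norm_real, Real.norm_eq_abs, abs_of_pos hs.1]
      exact pow_le_one₀ hs.1.le hs.2)
    (Eventually.of_forall fun s _ => hs) intervalIntegrable_const
    (by
      have hne : ∀ᵐ s : ℝ ∂MeasureTheory.volume, s ≠ 1 := by
        simp [MeasureTheory.ae_iff]
      filter_upwards [hne] with s hs1 hs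
      rw [uIoc_of_le zero_le_one] at hs
      have h1 : (1 : ℂ) - s ≠ 0 := by
        rw [sub_ne_zero]; exact_mod_cast hs1.symm
      have hsz := hf (s * z) (by
        rw [norm_mul, Complex.norm_real, Real.norm_eq_abs, abs_of_pos hs.1]
        exact (mul_le_of_le_one_left (norm_nonneg _) hs.2).trans_lt hz)
      refine (((hf z hz).sub hsz).div_const (1 - s : ℂ)).congr_fun fun n => ?_
      have hg := geom_sum_mul_neg (s : ℂ) n
      rw [eq_div_iff h1, mul_assoc, hg]
      ring)
  refine key.congr_fun fun n => ?_
  rw [intervalIntegral.integral_const_mul, intervalIntegral.integral_finsetSum]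
  · have : ∀ j : ℕ, ∫ s in (0 : ℝ)..1, (s : ℂ) ^ j = 1 / (j + 1) := by
      intro j
      have : ∀ s : ℝ, (s : ℂ) ^ j = ((s ^ j : ℝ) : ℂ) := fun s => by push_cast; rfl
      simp only [this]
      rw [intervalIntegral.integral_ofReal, integral_pow]
      simp
    simp only [this, _root_.harmonic]
    push_cast
    simp only [one_div]
    ring
  · intro j _
    exact (by fun_prop : Continuous fun s : ℝ => (s : ℂ) ^ j).intervalIntegrable _ _

/-! ### The functions `(e ^ u - 1) / u` and `w / (e ^ w - 1)` -/

/-- The entire function `(e ^ u - 1) / u`, with value `1` at `0`. -/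
noncomputable def expQuot : ℂ → ℂ := dslope Complex.exp 0

theorem expQuot_of_ne {u : ℂ} (hu : u ≠ 0) : expQuot u = (Complex.exp u - 1) / u := by
  rw [expQuot, dslope_of_ne _ hu, slope_def_field]; simp

theorem expQuot_zero : expQuot 0 = 1 := by
  rw [expQuot, dslope_same]; simp

theorem mul_expQuot (u : ℂ) : u * expQuot u = Complex.exp u - 1 := by
  by_cases hu : u = 0
  · simp [hu]
  · rw [expQuot_of_ne hu]; field_simp

theorem differentiable_expQuot : Differentiable ℂ expQuot := by
  rw [← differentiableOn_univ]
  exact (Complex.differentiableOn_dslope univ_mem).2 Complex.differentiable_exp.differentiableOn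

theorem continuous_expQuot : Continuous expQuot := differentiable_expQuot.continuous

theorem hasExpansion_exp (r : ℝ) : HasExpansion r (fun n => ((1 / n.factorial : ℚ) : ℂ)) Complex.exp := by
  intro z _
  have := NormedSpace.expSeries_div_hasSum_exp z
  rw [← Complex.exp_eq_exp_ℂ] at this
  refine this.congr_fun fun n => ?_
  push_cast; ring

theorem hasExpansion_expQuot (r : ℝ) :
    HasExpansion r (fun n => ((1 / (n + 1).factorial : ℚ) : ℂ)) expQuot :=
  (hasExpansion_exp r).dslope

theorem norm_expQuot_le (u : ℂ) : ‖expQuot u‖ ≤ Real.exp ‖u‖ := by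
  have h1 := hasExpansion_expQuot (‖u‖ + 1) u (by linarith)
  have h2 : HasSum (fun n : ℕ => ‖u‖ ^ n / n.factorial) (Real.exp ‖u‖) := by
    rw [Real.exp_eq_exp_ℝ]; exact NormedSpace.expSeries_div_hasSum_exp ‖u‖
  rw [← h1.tsum_eq]
  refine tsum_of_norm_bounded h2 fun n => ?_
  have : ((1 / (n + 1).factorial : ℚ) : ℂ) = (((1 / (n + 1).factorial : ℝ)) : ℂ) := by push_cast; rfl
  beta_reduce
  rw [this, norm_mul, Complex.norm_real, Real.norm_eq_abs, abs_of_pos (by positivity), norm_pow,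
    div_eq_inv_mul, mul_one, div_eq_inv_mul]
  gcongr
  omega

theorem expQuot_ne_zero {u : ℂ} (hu : ‖u‖ < 2 * Real.pi) : expQuot u ≠ 0 := by
  by_cases h0 : u = 0
  · rw [h0, expQuot_zero]; exact one_ne_zero
  intro h
  have h1 := mul_expQuot u
  rw [h, mul_zero, eq_comm, sub_eq_zero, Complex.exp_eq_one_iff] at h1
  obtain ⟨n, hn⟩ := h1
  have hn0 : n ≠ 0 := by rintro rfl; simp at hn; exact h0 hn
  have h2 : (1 : ℝ) ≤ |(n : ℝ)| := by
    exact_mod_cast Int.one_le_abs hn0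
  rw [hn] at hu
  simp [abs_of_pos Real.pi_pos] at hu
  nlinarith [Real.pi_pos]

theorem exp_sub_one_ne_zero {u : ℂ} (hu : ‖u‖ < 2 * Real.pi) (h0 : u ≠ 0) :
    Complex.exp u - 1 ≠ 0 := by
  rw [← mul_expQuot]; exact mul_ne_zero h0 (expQuot_ne_zero hu)

theorem expQuot_eq_integral (u : ℂ) : expQuot u = ∫ t in (0 : ℝ)..1, Complex.exp (u * t) := by
  by_cases h0 : u = 0
  · simp [h0, expQuot_zero]
  · rw [integral_exp_mul_complex h0, expQuot_of_ne h0]; simp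

/-- For `0 < Im u < π` the average of `e ^ (t u)`, `0 ≤ t ≤ 1`, has positive imaginary part, since
all the averaged values have. -/
theorem expQuot_im_pos {u : ℂ} (h0 : 0 < u.im) (h1 : u.im < Real.pi) : 0 < (expQuot u).im := by
  have hcont : Continuous fun t : ℝ => Complex.exp (u * t) := by fun_prop
  have him : (expQuot u).im = ∫ t in (0 : ℝ)..1, (Complex.exp (u * t)).im := by
    rw [expQuot_eq_integral]
    have := Complex.imCLM.intervalIntegral_comp_comm (hcont.intervalIntegrable (μ := MeasureTheory.volume) 0 1)
    simpa using this.symm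
  rw [him]
  refine intervalIntegral.intervalIntegral_pos_of_pos_on
    ((Complex.continuous_im.comp hcont).intervalIntegrable _ _) (fun t ht => ?_) one_pos
  rw [Complex.exp_im]
  refine mul_pos (Real.exp_pos _) (Real.sin_pos_of_pos_of_lt_pi ?_ ?_)
  · simp; exact mul_pos h0 ht.1
  · simp; nlinarith [ht.1, ht.2]

theorem expQuot_conj (u : ℂ) : expQuot (starRingEnd ℂ u) = starRingEnd ℂ (expQuot u) := by
  by_cases h0 : u = 0
  · simp [h0, expQuot_zero]
  · rw [expQuot_of_ne h0, expQuot_of_ne (by simpa using h0), Complex.exp_conj]; simp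

/-- This keeps `z / (1 - e ^ (-z)) = 1 / expQuot (-z)` away from the branch cut of the logarithm. -/
theorem expQuot_mem_slitPlane {u : ℂ} (hu : |u.im| < Real.pi) : expQuot u ∈ slitPlane := by
  rw [Complex.mem_slitPlane_iff]
  rcases lt_trichotomy u.im 0 with h | h | h
  · right
    have := expQuot_im_pos (u := starRingEnd ℂ u) (by simpa using h)
      (by simp; linarith [(abs_lt.1 hu).1])
    rw [expQuot_conj, Complex.conj_im] at this
    linarith
  · left
    have hre : u = (u.re : ℂ) := by apply Complex.ext <;> simp [h]
    rw [hre]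
    by_cases h0 : u.re = 0
    · simp [h0, expQuot_zero]
    rw [expQuot_of_ne (by exact_mod_cast h0)]
    have : (Complex.exp u.re - 1) / (u.re : ℂ) = (((Real.exp u.re - 1) / u.re : ℝ) : ℂ) := by
      push_cast; rfl
    rw [this, Complex.ofReal_re]
    rcases lt_or_gt_of_ne h0 with h1 | h1
    · exact div_pos_of_neg_of_neg (sub_neg.2 (by rwa [← Real.exp_zero, Real.exp_lt_exp])) h1
    · exact div_pos (by have := Real.one_lt_exp_iff.2 h1; linarith) h1
  · exact Or.inr (expQuot_im_pos h (abs_lt.1 hu).2).ne'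

/-- The function `w / (e ^ w - 1)`, with value `1` at `0`. -/
noncomputable def todd (w : ℂ) : ℂ := (expQuot w)⁻¹

theorem todd_zero : todd 0 = 1 := by rw [todd, expQuot_zero, inv_one]

theorem todd_of_ne {w : ℂ} (hw : w ≠ 0) : todd w = w / (Complex.exp w - 1) := by
  rw [todd, expQuot_of_ne hw, inv_div]

theorem differentiableOn_todd : DifferentiableOn ℂ todd (Metric.ball 0 (2 * Real.pi)) :=
  differentiable_expQuot.differentiableOn.inv fun w hw => expQuot_ne_zero (by simpa using hw)

/-- The bound comes from `ζ(2k) ≤ ζ(2) ≤ 2`. -/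
theorem norm_bernoulli_div_factorial_le (n : ℕ) :
    ‖((bernoulli n / n.factorial : ℚ) : ℂ)‖ ≤ 4 / (2 * Real.pi) ^ n := by
  have hcast : ((bernoulli n / n.factorial : ℚ) : ℂ) = ((bernoulli n / n.factorial : ℝ) : ℂ) := by
    push_cast; rfl
  rw [hcast, Complex.norm_real, Real.norm_eq_abs]
  rcases Nat.even_or_odd' n with ⟨k, rfl | rfl⟩
  · rcases eq_or_ne k 0 with rfl | hk
    · simp
    have hz := hasSum_zeta_nat hk
    have h2 := hasSum_zeta_two
    have hle : (-1 : ℝ) ^ (k + 1) * (2 : ℝ) ^ (2 * k - 1) * Real.pi ^ (2 * k) *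
        bernoulli (2 * k) / (2 * k).factorial ≤ Real.pi ^ 2 / 6 := by
      refine hasSum_le (fun n => ?_) hz h2
      rcases Nat.eq_zero_or_pos n with rfl | hn
      · simp [hk]
      · have : (1 : ℝ) ≤ n := by exact_mod_cast hn
        gcongr
        omega
    have h0 : 0 ≤ (-1 : ℝ) ^ (k + 1) * (2 : ℝ) ^ (2 * k - 1) * Real.pi ^ (2 * k) *
        bernoulli (2 * k) / (2 * k).factorial := hz.nonneg fun n => by positivity
    have hpi : Real.pi ^ 2 / 6 ≤ 2 := by
      nlinarith [Real.pi_lt_d2, Real.pi_gt_three]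
    have h4 : 2 * ((2 : ℝ) ^ (2 * k - 1)) = 2 ^ (2 * k) := by
      rw [← pow_succ']; congr 1; omega
    have habs := abs_of_nonneg h0
    have hfac : (-1 : ℝ) ^ (k + 1) * (2 : ℝ) ^ (2 * k - 1) * Real.pi ^ (2 * k) *
        bernoulli (2 * k) / (2 * k).factorial =
        ((-1 : ℝ) ^ (k + 1) * ((2 : ℝ) ^ (2 * k - 1) * Real.pi ^ (2 * k))) *
        (bernoulli (2 * k) / (2 * k).factorial) := by ring
    rw [hfac, abs_mul, abs_mul, abs_pow, abs_neg, abs_one, one_pow, one_mul,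
      abs_of_pos (by positivity : (0 : ℝ) < (2 : ℝ) ^ (2 * k - 1) * Real.pi ^ (2 * k))] at habs
    rw [hfac] at hle
    rw [le_div_iff₀ (by positivity), mul_pow, ← h4]
    linarith
  · rcases eq_or_ne k 0 with rfl | hk
    · simp only [mul_zero, zero_add, bernoulli_one, Nat.factorial_one, pow_one]
      rw [le_div_iff₀ (by positivity)]
      norm_num [abs_of_pos]
      linarith [Real.pi_lt_four]
    · rw [bernoulli_eq_zero_of_odd ⟨k, rfl⟩ (by omega)]
      simp; positivity

theorem summable_bernoulli {w : ℂ} (hw : ‖w‖ < 2 * Real.pi) :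
    Summable fun n : ℕ => ‖((bernoulli n / n.factorial : ℚ) : ℂ) * w ^ n‖ := by
  have hg := (summable_geometric_of_lt_one (r := ‖w‖ / (2 * Real.pi)) (by positivity)
    ((div_lt_one (by positivity)).2 hw)).mul_left 4
  refine Summable.of_nonneg_of_le (fun n => norm_nonneg _) (fun n => ?_) hg
  rw [norm_mul, norm_pow, div_pow]
  calc _ ≤ 4 / (2 * Real.pi) ^ n * ‖w‖ ^ n := by
        gcongr; exact norm_bernoulli_div_factorial_le n
    _ = _ := by ring

/-- The Bernoulli generating function, as a function on the disc `‖w‖ < 2π`. -/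
theorem hasExpansion_todd :
    HasExpansion (2 * Real.pi) (fun n => ((bernoulli n / n.factorial : ℚ) : ℂ)) todd := by
  have hT : HasExpansion (2 * Real.pi) (fun n => ((bernoulli n / n.factorial : ℚ) : ℂ))
      (fun w => ∑' n : ℕ, ((bernoulli n / n.factorial : ℚ) : ℂ) * w ^ n) := fun w hw =>
    (summable_bernoulli hw).of_norm.hasSum
  have hprod := hT.mul (hasExpansion_expQuot (2 * Real.pi))
  have hcoeff : ∀ n : ℕ, ∑ p ∈ Finset.HasAntidiagonal.antidiagonal n,
      ((bernoulli p.1 / p.1.factorial : ℚ) : ℂ) * ((1 / (p.2 + 1).factorial : ℚ) : ℂ)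
        = if n = 0 then 1 else 0 := by
    intro n
    have h := congrArg (PowerSeries.coeff (n + 1)) (bernoulliPowerSeries_mul_exp_sub_one ℚ)
    rw [PowerSeries.coeff_mul, Finset.Nat.sum_antidiagonal_succ'] at h
    simp [bernoulliPowerSeries, PowerSeries.coeff_exp, PowerSeries.coeff_X] at h
    have h' : ∑ p ∈ Finset.HasAntidiagonal.antidiagonal n,
      (bernoulli p.1 / p.1.factorial : ℚ) * (1 / (p.2 + 1).factorial : ℚ)
        = if n = 0 then 1 else 0 := by
      rw [← h]
      refine Finset.sum_congr rfl fun p _ => ?_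
      simp
    have h2 := congrArg (fun q : ℚ => (q : ℂ)) h'
    push_cast at h2 ⊢
    rw [h2]
    split_ifs <;> simp
  intro w hw
  have h1 := hprod w hw
  simp only [hcoeff] at h1
  have h2 := hasSum_single (f := fun n : ℕ => (if n = 0 then (1:ℂ) else 0) * w ^ n) 0
    (fun n hn => by simp [hn])
  have h3 := h1.unique h2
  simp only [if_true, pow_zero, mul_one] at h3
  have h4 := hT w hw
  beta_reduce at h4
  rwa [eq_inv_of_mul_eq_one_left h3] at h4

/-- The function `1 / (e ^ w - 1) - 1 / w`, with value `-1 / 2` at `0`. -/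
noncomputable def toddQuot : ℂ → ℂ := dslope todd 0

theorem toddQuot_of_ne {w : ℂ} (hw : w ≠ 0) :
    toddQuot w = 1 / (Complex.exp w - 1) - 1 / w := by
  rw [toddQuot, dslope_of_ne _ hw, slope_def_field, todd_zero, todd_of_ne hw, sub_zero, sub_div,
    div_right_comm, div_self hw]

theorem differentiableOn_toddQuot :
    DifferentiableOn ℂ toddQuot (Metric.ball 0 (2 * Real.pi)) :=
  (Complex.differentiableOn_dslope (Metric.ball_mem_nhds _ (by positivity))).2 differentiableOn_todd

theorem hasExpansion_toddQuot : HasExpansion (2 * Real.pi)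
    (fun n => ((bernoulli (n + 1) / (n + 1).factorial : ℚ) : ℂ)) toddQuot :=
  hasExpansion_todd.dslope

/-! ### Harmonic numbers at complex arguments -/

/-- The holomorphic extension `∑_{k ≥ 1} (1 / k - 1 / (k + x))` of the harmonic numbers. -/
noncomputable def harmonicFun (x : ℂ) : ℂ := ∑' k : ℕ, x / ((k + 1) * (k + 1 + x))

theorem natCast_add_one_le_norm {x : ℂ} (hx : 0 ≤ x.re) (k : ℕ) : (k : ℝ) + 1 ≤ ‖(k : ℂ) + 1 + x‖ := by
  refine le_trans ?_ (Complex.re_le_norm _)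
  simp; linarith

theorem natCast_add_one_add_ne_zero {x : ℂ} (hx : 0 ≤ x.re) (k : ℕ) : (k : ℂ) + 1 + x ≠ 0 := by
  intro h
  have := natCast_add_one_le_norm hx k
  rw [h, norm_zero] at this
  have : (0 : ℝ) ≤ k := Nat.cast_nonneg k
  linarith

theorem norm_harmonicFun_term_le {x : ℂ} (hx : 0 ≤ x.re) (k : ℕ) :
    ‖x / ((k + 1) * (k + 1 + x))‖ ≤ ‖x‖ * (1 / ((k : ℝ) + 1) ^ 2) := by
  have h1 := natCast_add_one_le_norm hx k
  have h2 : ‖(k : ℂ) + 1‖ = (k : ℝ) + 1 := by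
    have : (k : ℂ) + 1 = ((k + 1 : ℝ) : ℂ) := by push_cast; rfl
    rw [this, Complex.norm_real, Real.norm_eq_abs, abs_of_nonneg (by positivity)]
  rw [norm_div, norm_mul, h2, div_eq_mul_one_div, sq]
  gcongr

theorem hasSum_one_div_succ_sq :
    HasSum (fun k : ℕ => 1 / ((k : ℝ) + 1) ^ 2) (Real.pi ^ 2 / 6) := by
  have := (hasSum_nat_add_iff' 1).2 hasSum_zeta_two
  simpa using this

theorem hasSum_harmonicFun {x : ℂ} (hx : 0 ≤ x.re) :
    HasSum (fun k : ℕ => x / ((k + 1) * (k + 1 + x))) (harmonicFun x) :=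
  (Summable.of_norm_bounded (hasSum_one_div_succ_sq.summable.mul_left ‖x‖)
    (norm_harmonicFun_term_le hx)).hasSum

theorem norm_harmonicFun_le {x : ℂ} (hx : 0 ≤ x.re) : ‖harmonicFun x‖ ≤ 2 * ‖x‖ := by
  refine (tsum_of_norm_bounded (hasSum_one_div_succ_sq.mul_left ‖x‖)
    (norm_harmonicFun_term_le hx)).trans ?_
  rw [mul_comm]
  gcongr
  nlinarith [Real.pi_lt_d2, Real.pi_gt_three]

theorem differentiableOn_harmonicFun : DifferentiableOn ℂ harmonicFun {x | 0 < x.re} := by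
  intro x hx
  set U : Set ℂ := {x | 0 < x.re} ∩ Metric.ball 0 (‖x‖ + 1)
  have hU : IsOpen U := isOpen_re_pos.inter Metric.isOpen_ball
  have hd : DifferentiableOn ℂ harmonicFun U := by
    refine differentiableOn_tsum_of_summable_norm
      (hasSum_one_div_succ_sq.summable.mul_left (‖x‖ + 1)) (fun k => ?_) hU (fun k w hw => ?_)
    · refine DifferentiableOn.div (by fun_prop) (by fun_prop) fun w hw => ?_
      refine mul_ne_zero ?_ (natCast_add_one_add_ne_zero (le_of_lt hw.1) k)
      exact_mod_cast Nat.succ_ne_zero k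
    · refine (norm_harmonicFun_term_le (le_of_lt hw.1) k).trans ?_
      have : ‖w‖ ≤ ‖x‖ + 1 := by
        have : ‖w‖ < ‖x‖ + 1 := by simpa using hw.2
        exact this.le
      gcongr
  have hxU : x ∈ U := ⟨hx, by simp⟩
  exact ((hd x hxU).differentiableAt (hU.mem_nhds hxU)).differentiableWithinAt

theorem harmonicFun_add_one {x : ℂ} (hx : 0 ≤ x.re) :
    harmonicFun (x + 1) = harmonicFun x + 1 / (x + 1) := by
  have hx1 : 0 ≤ (x + 1).re := by simp; linarith
  have h := ((hasSum_harmonicFun hx1).sub (hasSum_harmonicFun hx)).tendsto_sum_nat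
  have hpart : ∀ n : ℕ, ∑ k ∈ Finset.range n,
      ((x + 1) / ((k + 1) * (k + 1 + (x + 1))) - x / ((k + 1) * (k + 1 + x)))
        = 1 / (x + 1) - 1 / (n + 1 + x) := by
    intro n
    induction n with
    | zero => simp [add_comm]
    | succ n ih =>
      rw [Finset.sum_range_succ, ih]
      have h0 : (n : ℂ) + 1 ≠ 0 := by exact_mod_cast Nat.succ_ne_zero n
      have h1 := natCast_add_one_add_ne_zero hx n
      have h2 := natCast_add_one_add_ne_zero hx1 n
      have h3 : ((n + 1 : ℕ) : ℂ) + 1 + x = n + 1 + (x + 1) := by push_cast; ring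
      rw [h3]
      have h4 : x + 1 ≠ 0 := by
        have := natCast_add_one_add_ne_zero hx 0
        simpa [add_comm] using this
      field_simp
      ring
  simp only [hpart] at h
  have hlim : Tendsto (fun n : ℕ => 1 / (x + 1) - 1 / ((n : ℂ) + 1 + x)) atTop (𝓝 (1 / (x + 1) - 0)) := by
    refine Tendsto.const_sub _ ?_
    rw [tendsto_zero_iff_norm_tendsto_zero]
    refine squeeze_zero (fun n => norm_nonneg _) (fun n => ?_)
      tendsto_one_div_add_atTop_nhds_zero_nat
    rw [norm_div, norm_one]
    exact one_div_le_one_div_of_le (by positivity) (natCast_add_one_le_norm hx n)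
  have := tendsto_nhds_unique h hlim
  rw [sub_zero, sub_eq_iff_eq_add] at this
  rw [this, add_comm]

theorem harmonicFun_natCast (n : ℕ) : harmonicFun n = (harmonic n : ℂ) := by
  induction n with
  | zero => simp [harmonicFun]
  | succ n ih =>
    push_cast
    rw [harmonicFun_add_one (by simp), ih, harmonic_succ]
    push_cast
    rw [one_div]

/-- The function `x ↦ H_{x - 1}`, that is `ψ(x) + γ` with the digamma function `ψ`. -/
noncomputable def harmonicPred (x : ℂ) : ℂ := harmonicFun x - 1 / x

theorem differentiableOn_harmonicPred : DifferentiableOn ℂ harmonicPred {x | 0 < x.re} := by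
  refine differentiableOn_harmonicFun.sub ?_
  refine DifferentiableOn.div (by fun_prop) (by fun_prop) fun x hx h => ?_
  subst h
  simp at hx

theorem harmonicPred_add_one {x : ℂ} (hx : 0 ≤ x.re) : harmonicPred (x + 1) = harmonicFun x := by
  rw [harmonicPred, harmonicFun_add_one hx]; ring

theorem harmonicPred_one : harmonicPred 1 = 0 := by
  have := harmonicFun_natCast 1
  rw [harmonicPred]
  push_cast at this
  rw [this]
  simp

theorem norm_harmonicPred_le {x : ℂ} (hx : 1 / 2 ≤ x.re) : ‖harmonicPred x‖ ≤ 2 * (1 + ‖x‖) := by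
  have h1 := norm_harmonicFun_le (by linarith : 0 ≤ x.re)
  have h2 : (1 / 2 : ℝ) ≤ ‖x‖ := hx.trans (Complex.re_le_norm x)
  refine (norm_sub_le _ _).trans ?_
  have h3 : ‖1 / x‖ ≤ 2 := by
    rw [norm_div, norm_one, div_le_iff₀ (by linarith)]; linarith
  linarith

/-- The normalisation of the digamma function: `∫₁² ψ = log Γ(2) - log Γ(1) = 0`. -/
theorem integral_harmonicPred :
    ∫ t in (1 : ℝ)..2, harmonicPred t = (Real.eulerMascheroniConstant : ℂ) := by
  have hF : ∀ (k : ℕ), ∫ t in (1 : ℝ)..2, ((t : ℂ) / ((k + 1) * (k + 1 + t))) =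
      ((1 / ((k : ℝ) + 1) - (Real.log (k + 3) - Real.log (k + 2)) : ℝ) : ℂ) := by
    intro k
    have hk : (0 : ℝ) ≤ k := Nat.cast_nonneg k
    have h1 : ∫ t in (1 : ℝ)..2, ((t : ℂ) / ((k + 1) * (k + 1 + t))) =
        ∫ t in (1 : ℝ)..2, ((1 / ((k : ℝ) + 1) - 1 / (k + 1 + t) : ℝ) : ℂ) := by
      refine intervalIntegral.integral_congr fun t ht => ?_
      rw [uIcc_of_le (by norm_num)] at ht
      have h3 : (k : ℝ) + 1 + t ≠ 0 := by linarith [ht.1]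
      have h4 : (k : ℝ) + 1 ≠ 0 := by linarith
      have : (t : ℂ) / ((k + 1) * (k + 1 + t)) = ((t / ((k + 1) * (k + 1 + t)) : ℝ) : ℂ) := by
        push_cast; rfl
      simp only [this]
      congr 1
      field_simp
      ring
    rw [h1, intervalIntegral.integral_ofReal]
    congr 1
    have h2 : ∀ t ∈ uIcc (1 : ℝ) 2,
        HasDerivAt (fun t => t / (k + 1) - Real.log (k + 1 + t))
          (1 / ((k : ℝ) + 1) - 1 / (k + 1 + t)) t := by
      intro t ht
      rw [uIcc_of_le (by norm_num)] at ht
      have h3 : (k : ℝ) + 1 + t ≠ 0 := by linarith [ht.1]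
      exact ((hasDerivAt_id t).div_const _).sub (((hasDerivAt_id t).const_add _).log h3)
    rw [intervalIntegral.integral_eq_sub_of_hasDerivAt h2]
    · rw [show (k : ℝ) + 1 + 2 = k + 3 by ring, show (k : ℝ) + 1 + 1 = k + 2 by ring]
      ring
    · apply ContinuousOn.intervalIntegrable
      refine continuousOn_const.sub (ContinuousOn.div continuousOn_const (by fun_prop) ?_)
      intro t ht
      rw [uIcc_of_le (by norm_num)] at ht
      linarith [ht.1]
  have hsum := intervalIntegral.hasSum_integral_of_dominated_convergence (a := (1:ℝ)) (b := 2)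
    (μ := MeasureTheory.volume) (F := fun (k : ℕ) (t : ℝ) => (t : ℂ) / ((k + 1) * (k + 1 + t)))
    (f := fun t : ℝ => harmonicFun t) (fun k _ => 2 * (1 / ((k : ℝ) + 1) ^ 2))
    (fun k => by
      apply Measurable.aestronglyMeasurable
      fun_prop)
    (fun k => Eventually.of_forall fun t ht => by
      rw [uIoc_of_le (by norm_num)] at ht
      have ht0 : (0 : ℝ) ≤ t := by linarith [ht.1]
      refine (norm_harmonicFun_term_le (by simpa using ht0) k).trans ?_
      have : ‖(t : ℂ)‖ ≤ 2 := by
        rw [Complex.norm_real, Real.norm_eq_abs, abs_of_nonneg ht0]; exact ht.2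
      gcongr)
    (Eventually.of_forall fun t _ => hasSum_one_div_succ_sq.summable.mul_left 2)
    intervalIntegrable_const
    (Eventually.of_forall fun t ht => by
      rw [uIoc_of_le (by norm_num)] at ht
      exact hasSum_harmonicFun (by simp; linarith [ht.1]))
  simp only [hF] at hsum
  have htend := hsum.tendsto_sum_nat
  have hpart : ∀ n : ℕ, ∑ k ∈ Finset.range n,
      ((1 / ((k : ℝ) + 1) - (Real.log (k + 3) - Real.log (k + 2)) : ℝ) : ℂ) =
      ((Real.eulerMascheroniSeq (n + 1) - 1 / ((n : ℝ) + 1) + Real.log 2 : ℝ) : ℂ) := by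
    intro n
    rw [← Complex.ofReal_sum]
    congr 1
    induction n with
    | zero =>
      simp only [Real.eulerMascheroniSeq]
      norm_num
    | succ n ih =>
      rw [Finset.sum_range_succ, ih]
      simp only [Real.eulerMascheroniSeq, harmonic_succ]
      push_cast
      rw [show (n : ℝ) + 1 + 1 + 1 = n + 3 by ring, show (n : ℝ) + 1 + 1 = n + 2 by ring]
      ring
  simp only [hpart] at htend
  have hlim : Tendsto (fun n : ℕ => ((Real.eulerMascheroniSeq (n + 1) - 1 / ((n : ℝ) + 1)
      + Real.log 2 : ℝ) : ℂ)) atTop (𝓝 ((Real.eulerMascheroniConstant - 0 + Real.log 2 : ℝ) : ℂ)) := by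
    refine (Complex.continuous_ofReal.tendsto _).comp ?_
    exact (((tendsto_add_atTop_iff_nat 1).2 Real.tendsto_eulerMascheroniSeq).sub
      tendsto_one_div_add_atTop_nhds_zero_nat).add_const _
  have hval := tendsto_nhds_unique htend hlim
  have hinv : ∫ t in (1 : ℝ)..2, (1 : ℂ) / t = (Real.log 2 : ℂ) := by
    have : ∀ t : ℝ, (1 : ℂ) / t = ((1 / t : ℝ) : ℂ) := fun t => by push_cast; rfl
    simp only [this]
    rw [intervalIntegral.integral_ofReal, integral_one_div_of_pos one_pos two_pos]
    simp
  simp only [harmonicPred]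
  rw [intervalIntegral.integral_sub, hval, hinv]
  · push_cast; ring
  · exact intervalIntegrable_ofReal_of_differentiableOn differentiableOn_harmonicFun
  · apply ContinuousOn.intervalIntegrable
    refine continuousOn_const.div (by fun_prop) fun t ht => ?_
    rw [uIcc_of_le (by norm_num)] at ht
    have : t ≠ 0 := by linarith [ht.1]
    exact_mod_cast this

/-! ### The elementary part of the remainder of `e ^ (x z) / x` -/

/-- The function `e ^ (x w) / (1 - e ^ w) + e ^ w / w`, continued to `w = 0`. -/
noncomputable def genKernel (x w : ℂ) : ℂ :=
  -((x - 1) * Complex.exp w * expQuot ((x - 1) * w) * todd w + Complex.exp w * toddQuot w)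

theorem genKernel_of_ne {x w : ℂ} (h0 : w ≠ 0) (hw : ‖w‖ < 2 * Real.pi) :
    genKernel x w = Complex.exp (x * w) / (1 - Complex.exp w) + Complex.exp w / w := by
  have h1 := exp_sub_one_ne_zero hw h0
  have h2 := mul_expQuot ((x - 1) * w)
  have h3 : (x - 1) * expQuot ((x - 1) * w) = (Complex.exp ((x - 1) * w) - 1) / w := by
    rw [← h2]; field_simp
  have h4 : Complex.exp (x * w) = Complex.exp ((x - 1) * w) * Complex.exp w := by
    rw [← Complex.exp_add]; ring_nf
  have h5 : 1 - Complex.exp w = -(Complex.exp w - 1) := by ring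
  rw [genKernel, mul_right_comm (x - 1), h3, todd_of_ne h0, toddQuot_of_ne h0, h4, h5]
  field_simp
  ring

/-- The part of the remainder of `e ^ (x z) / x` that is entire in `x`; the digamma function is the
other part. In terms of Bernoulli polynomials it is `-∑_{n ≥ 1} B_n(x) z ^ n / (n n!)` up to a
constant that makes its mean value on `[1, 2]` vanish. -/
noncomputable def entirePart (z x : ℂ) : ℂ := z * ∫ s in (0 : ℝ)..1, genKernel x (s * z)

theorem norm_ofReal_mul_le {s : ℝ} (hs : s ∈ Icc (0 : ℝ) 1) (z : ℂ) : ‖(s : ℂ) * z‖ ≤ ‖z‖ := by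
  rw [norm_mul, Complex.norm_real, Real.norm_eq_abs, abs_of_nonneg hs.1]
  exact mul_le_of_le_one_left (norm_nonneg _) hs.2

theorem continuousOn_todd_ofReal_mul {z : ℂ} (hz : ‖z‖ < 2 * Real.pi) :
    ContinuousOn (fun s : ℝ => todd (s * z)) (Icc 0 1) :=
  differentiableOn_todd.continuousOn.comp (by fun_prop) fun s hs => by
    simpa using (norm_ofReal_mul_le hs z).trans_lt hz

theorem continuousOn_toddQuot_ofReal_mul {z : ℂ} (hz : ‖z‖ < 2 * Real.pi) :
    ContinuousOn (fun s : ℝ => toddQuot (s * z)) (Icc 0 1) :=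
  differentiableOn_toddQuot.continuousOn.comp (by fun_prop) fun s hs => by
    simpa using (norm_ofReal_mul_le hs z).trans_lt hz

theorem continuousOn_genKernel {z : ℂ} (hz : ‖z‖ < 2 * Real.pi) :
    ContinuousOn (fun p : ℂ × ℝ => genKernel p.1 (p.2 * z)) (univ ×ˢ Icc 0 1) := by
  have h1 := (continuousOn_todd_ofReal_mul hz).comp (s := (univ : Set ℂ) ×ˢ Icc (0:ℝ) 1)
    continuous_snd.continuousOn (fun p hp => hp.2)
  have h2 := (continuousOn_toddQuot_ofReal_mul hz).comp (s := (univ : Set ℂ) ×ˢ Icc (0:ℝ) 1)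
    continuous_snd.continuousOn (fun p hp => hp.2)
  have h3 : Continuous fun p : ℂ × ℝ =>
      (p.1 - 1) * Complex.exp (p.2 * z) * expQuot ((p.1 - 1) * (p.2 * z)) := by
    have := continuous_expQuot
    fun_prop
  have h4 : Continuous fun p : ℂ × ℝ => Complex.exp (p.2 * z) := by fun_prop
  exact ((h3.continuousOn.mul h1).add (h4.continuousOn.mul h2)).neg

theorem continuousOn_genKernel_right {z : ℂ} (hz : ‖z‖ < 2 * Real.pi) (x : ℂ) :
    ContinuousOn (fun s : ℝ => genKernel x (s * z)) (Icc 0 1) :=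
  (continuousOn_genKernel hz).comp (f := fun s : ℝ => ((x, s) : ℂ × ℝ)) (by fun_prop)
    fun s hs => ⟨mem_univ _, hs⟩

theorem intervalIntegrable_genKernel {z : ℂ} (hz : ‖z‖ < 2 * Real.pi) (x : ℂ) :
    IntervalIntegrable (fun s : ℝ => genKernel x (s * z)) MeasureTheory.volume 0 1 := by
  apply ContinuousOn.intervalIntegrable
  rw [uIcc_of_le zero_le_one]
  exact continuousOn_genKernel_right hz x

/-- Fubini: an integral of `E_z` over `[1, 2]` may be computed with `x` as the inner variable, where
the integrand is an exponential. -/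
theorem integral_mul_entirePart {z : ℂ} (hz : ‖z‖ < 2 * Real.pi) {g : ℝ → ℂ} (hg : Continuous g) :
    ∫ x in (1 : ℝ)..2, g x * entirePart z x =
      z * ∫ s in (0 : ℝ)..1, ∫ x in (1 : ℝ)..2, g x * genKernel x (s * z) := by
  have h1 : ∀ x : ℝ, g x * entirePart z x =
      z * ∫ s in (0 : ℝ)..1, g x * genKernel x (s * z) := by
    intro x
    rw [intervalIntegral.integral_const_mul, entirePart]; ring
  simp only [h1]
  rw [intervalIntegral.integral_const_mul, MeasureTheory.intervalIntegral_intervalIntegral_swap]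
  have hc : ContinuousOn (Function.uncurry fun (x : ℝ) (s : ℝ) => g x * genKernel x (s * z))
      (Icc 1 2 ×ˢ Icc 0 1) := by
    refine ContinuousOn.mul (by fun_prop) ?_
    exact (continuousOn_genKernel hz).comp (f := fun p : ℝ × ℝ => (((p.1 : ℂ), p.2) : ℂ × ℝ))
      (by fun_prop) fun p hp => ⟨mem_univ _, hp.2⟩
  refine (hc.integrableOn_compact (isCompact_Icc.prod isCompact_Icc)).mono_set ?_
  rw [uIoc_of_le (by norm_num), uIoc_of_le zero_le_one]
  exact prod_mono Ioc_subset_Icc_self Ioc_subset_Icc_self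

theorem ofReal_mul_ne_zero {s : ℝ} (hs : s ∈ Ioo (0 : ℝ) 1) {z : ℂ} (h0 : z ≠ 0) :
    (s : ℂ) * z ≠ 0 :=
  mul_ne_zero (by exact_mod_cast hs.1.ne') h0

theorem integral_entirePart {z : ℂ} (hz : ‖z‖ < 2 * Real.pi) :
    ∫ x in (1 : ℝ)..2, entirePart z x = 0 := by
  by_cases h0 : z = 0
  · simp [entirePart, h0]
  have h := integral_mul_entirePart hz (g := fun _ => 1) continuous_const
  simp only [one_mul] at h
  rw [h]
  have : ∫ s in (0 : ℝ)..1, ∫ x in (1 : ℝ)..2, genKernel x (s * z) = ∫ s in (0 : ℝ)..1, (0 : ℂ) := by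
    refine intervalIntegral.integral_congr_Ioo_of_le zero_le_one fun s hs => ?_
    have hw0 := ofReal_mul_ne_zero hs h0
    have hw := (norm_ofReal_mul_le (Ioo_subset_Icc_self hs) z).trans_lt hz
    set w := (s : ℂ) * z
    have he := exp_sub_one_ne_zero hw hw0
    simp only [genKernel_of_ne hw0 hw, mul_comm _ w]
    rw [intervalIntegral.integral_add, intervalIntegral.integral_div, integral_exp_mul_complex hw0,
      intervalIntegral.integral_const]
    · have h2 : Complex.exp (w * (2 : ℝ)) = Complex.exp w * Complex.exp w := by
        rw [← Complex.exp_add]; push_cast; ring_nf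
      have h5 : 1 - Complex.exp w ≠ 0 := by rw [← neg_sub]; exact neg_ne_zero.2 he
      rw [h2, ofReal_one, mul_one, show (2 : ℝ) - 1 = 1 by norm_num, one_smul]
      field_simp
      ring
    · exact (by fun_prop : Continuous fun x : ℝ =>
        Complex.exp (w * x) / (1 - Complex.exp w)).intervalIntegrable _ _
    · exact intervalIntegrable_const
  rw [this]; simp

theorem genKernel_sub_genKernel_add_one {w : ℂ} (hw : ‖w‖ < 2 * Real.pi) (x : ℂ) :
    genKernel x w - genKernel (x + 1) w = Complex.exp (x * w) := by
  by_cases h0 : w = 0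
  · subst h0
    simp [genKernel, expQuot_zero, todd_zero]
  · have h1 := exp_sub_one_ne_zero hw h0
    have h4 : Complex.exp ((x + 1) * w) = Complex.exp (x * w) * Complex.exp w := by
      rw [← Complex.exp_add]; ring_nf
    have h5 : 1 - Complex.exp w ≠ 0 := by rw [← neg_sub]; exact neg_ne_zero.2 h1
    rw [genKernel_of_ne h0 hw, genKernel_of_ne h0 hw, h4]
    field_simp
    ring

theorem entirePart_sub_entirePart_add_one {z : ℂ} (hz : ‖z‖ < 2 * Real.pi) {x : ℂ} (hx : x ≠ 0) :
    entirePart z x - entirePart z (x + 1) = (Complex.exp (x * z) - 1) / x := by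
  rw [entirePart, entirePart, ← mul_sub, ← intervalIntegral.integral_sub
    (intervalIntegrable_genKernel hz x) (intervalIntegrable_genKernel hz (x + 1)),
    eq_div_iff hx, ← mul_expQuot (x * z), expQuot_eq_integral]
  have : ∫ s in (0 : ℝ)..1, (genKernel x (s * z) - genKernel (x + 1) (s * z)) =
      ∫ s in (0 : ℝ)..1, Complex.exp (x * z * s) := by
    refine intervalIntegral.integral_congr_Ioo_of_le zero_le_one fun s hs => ?_
    have hw := (norm_ofReal_mul_le (Ioo_subset_Icc_self hs) z).trans_lt hz
    simp only [genKernel_sub_genKernel_add_one hw]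
    ring_nf
  rw [this]; ring

theorem hasDerivAt_mul_expQuot (w x : ℂ) :
    HasDerivAt (fun x => (x - 1) * expQuot ((x - 1) * w)) (Complex.exp ((x - 1) * w)) x := by
  by_cases h0 : w = 0
  · subst h0
    simpa [expQuot_zero] using (hasDerivAt_id x).sub_const 1
  · have h : (fun x => (x - 1) * expQuot ((x - 1) * w)) =
        fun x => (Complex.exp ((x - 1) * w) - 1) / w := by
      ext x
      rw [← mul_expQuot]; field_simp
    rw [h]
    have h1 : HasDerivAt (fun x : ℂ => (x - 1) * w) (1 * w) x :=
      ((hasDerivAt_id x).sub_const 1).mul_const w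
    have h2 := (h1.cexp.sub_const 1).div_const w
    rwa [one_mul, mul_div_cancel_right₀ _ h0] at h2

theorem hasDerivAt_genKernel (x w : ℂ) :
    HasDerivAt (fun x => genKernel x w)
      (-(Complex.exp ((x - 1) * w) * (Complex.exp w * todd w))) x := by
  have h := (((hasDerivAt_mul_expQuot w x).mul_const (Complex.exp w * todd w)).add_const
    (Complex.exp w * toddQuot w)).neg
  refine h.congr_of_eventuallyEq (Eventually.of_forall fun y => ?_)
  simp only [genKernel, Pi.neg_apply]
  ring

theorem exists_norm_todd_le {z : ℂ} (hz : ‖z‖ < 2 * Real.pi) :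
    ∃ M : ℝ, 0 ≤ M ∧ ∀ s ∈ Icc (0 : ℝ) 1, ‖todd (s * z)‖ ≤ M ∧ ‖toddQuot (s * z)‖ ≤ M := by
  obtain ⟨M, hM⟩ := isCompact_Icc.exists_bound_of_continuousOn (continuousOn_todd_ofReal_mul hz)
  obtain ⟨N, hN⟩ := isCompact_Icc.exists_bound_of_continuousOn (continuousOn_toddQuot_ofReal_mul hz)
  refine ⟨max M N, ?_, fun s hs => ⟨(hM s hs).trans (le_max_left _ _),
    (hN s hs).trans (le_max_right _ _)⟩⟩
  exact ((norm_nonneg _).trans (hM 0 (by simp))).trans (le_max_left _ _)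

theorem differentiable_entirePart {z : ℂ} (hz : ‖z‖ < 2 * Real.pi) :
    Differentiable ℂ (entirePart z) := by
  intro x₀
  obtain ⟨M, hM0, hM⟩ := exists_norm_todd_le hz
  have key := intervalIntegral.hasDerivAt_integral_of_dominated_loc_of_deriv_le
    (μ := MeasureTheory.volume) (a := (0 : ℝ)) (b := 1) (x₀ := x₀) (s := Metric.ball x₀ 1)
    (F := fun x s => genKernel x (s * z))
    (F' := fun x s => -(Complex.exp ((x - 1) * (s * z)) * (Complex.exp (s * z) * todd (s * z))))
    (bound := fun _ => Real.exp ((‖x₀‖ + 2) * ‖z‖) * (Real.exp ‖z‖ * M))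
    (Metric.ball_mem_nhds _ one_pos)
    (Eventually.of_forall fun x => (intervalIntegrable_genKernel hz x).aestronglyMeasurable_restrict_uIoc)
    (intervalIntegrable_genKernel hz x₀)
    (by
      rw [uIoc_of_le zero_le_one]
      refine ContinuousOn.aestronglyMeasurable ?_ measurableSet_Ioc
      refine (ContinuousOn.neg (ContinuousOn.mul (by fun_prop) (ContinuousOn.mul (by fun_prop) ?_)))
      exact (continuousOn_todd_ofReal_mul hz).mono Ioc_subset_Icc_self)
    (Eventually.of_forall fun s hs x hx => by
      rw [uIoc_of_le zero_le_one] at hs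
      have hs' := Ioc_subset_Icc_self hs
      have hn := norm_ofReal_mul_le hs' z
      have hx1 : ‖x - 1‖ ≤ ‖x₀‖ + 2 := by
        have h1 : ‖x - x₀‖ < 1 := by simpa [dist_eq_norm] using hx
        calc ‖x - 1‖ = ‖(x - x₀) + x₀ - 1‖ := by ring_nf
          _ ≤ ‖(x - x₀) + x₀‖ + ‖(1 : ℂ)‖ := norm_sub_le _ _
          _ ≤ ‖x - x₀‖ + ‖x₀‖ + 1 := by rw [norm_one]; gcongr; exact norm_add_le _ _
          _ ≤ _ := by linarith
      rw [norm_neg, norm_mul, norm_mul]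
      refine mul_le_mul ((Complex.norm_exp_le_exp_norm _).trans ?_) (mul_le_mul
        ((Complex.norm_exp_le_exp_norm _).trans ?_) (hM s hs').1 (norm_nonneg _) (Real.exp_pos _).le)
        (by positivity) (Real.exp_pos _).le
      · rw [norm_mul]; gcongr
      · gcongr)
    intervalIntegrable_const
    (Eventually.of_forall fun s _ x _ => hasDerivAt_genKernel x (s * z))
  exact (key.2.differentiableAt).const_mul z

theorem exists_norm_entirePart_le {z : ℂ} (hz : ‖z‖ < 2 * Real.pi) :
    ∃ K : ℝ, 0 ≤ K ∧ ∀ x : ℂ, ‖entirePart z x‖ ≤ K * (1 + ‖x‖) * Real.exp (‖z‖ * ‖x‖) := by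
  obtain ⟨M, hM0, hM⟩ := exists_norm_todd_le hz
  have hz0 := norm_nonneg z
  refine ⟨‖z‖ * (Real.exp ‖z‖ * Real.exp ‖z‖ * M * 2), by positivity, fun x => ?_⟩
  have hx1 : ‖x - 1‖ ≤ 1 + ‖x‖ := by
    refine (norm_sub_le _ _).trans ?_
    rw [norm_one, add_comm]
  have hx0 := norm_nonneg x
  have hbound : ∀ s ∈ uIoc (0 : ℝ) 1, ‖genKernel x (s * z)‖ ≤
      Real.exp ‖z‖ * Real.exp ‖z‖ * M * 2 * (1 + ‖x‖) * Real.exp (‖z‖ * ‖x‖) := by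
    intro s hs
    rw [uIoc_of_le zero_le_one] at hs
    have hs' := Ioc_subset_Icc_self hs
    have hn := norm_ofReal_mul_le hs' z
    have he : ‖Complex.exp (s * z)‖ ≤ Real.exp ‖z‖ :=
      (Complex.norm_exp_le_exp_norm _).trans (by gcongr)
    have hq : ‖expQuot ((x - 1) * (s * z))‖ ≤ Real.exp ‖z‖ * Real.exp (‖z‖ * ‖x‖) := by
      refine (norm_expQuot_le _).trans ?_
      rw [← Real.exp_add, norm_mul]
      apply Real.exp_le_exp.2
      calc ‖x - 1‖ * ‖(s : ℂ) * z‖ ≤ (1 + ‖x‖) * ‖z‖ := by gcongr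
        _ = _ := by ring
    have h1 : ‖(x - 1) * Complex.exp (s * z) * expQuot ((x - 1) * (s * z)) * todd (s * z)‖ ≤
        (1 + ‖x‖) * Real.exp ‖z‖ * (Real.exp ‖z‖ * Real.exp (‖z‖ * ‖x‖)) * M := by
      rw [norm_mul, norm_mul, norm_mul]
      gcongr
      exact (hM s hs').1
    have h2 : ‖Complex.exp (s * z) * toddQuot (s * z)‖ ≤
        (1 + ‖x‖) * Real.exp ‖z‖ * (Real.exp ‖z‖ * Real.exp (‖z‖ * ‖x‖)) * M := by
      rw [norm_mul]
      have e1 : 1 ≤ Real.exp ‖z‖ := Real.one_le_exp hz0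
      have e2 : 1 ≤ Real.exp (‖z‖ * ‖x‖) := Real.one_le_exp (by positivity)
      have e3 : 1 ≤ Real.exp ‖z‖ * Real.exp (‖z‖ * ‖x‖) := one_le_mul_of_one_le_of_one_le e1 e2
      calc _ ≤ (1 * Real.exp ‖z‖ * 1) * M := by
            rw [one_mul, mul_one]
            exact mul_le_mul he (hM s hs').2 (norm_nonneg _) (Real.exp_pos _).le
        _ ≤ _ := by gcongr; linarith
    rw [genKernel, norm_neg]
    refine (norm_add_le _ _).trans ((add_le_add h1 h2).trans_eq ?_)
    ring
  have := intervalIntegral.norm_integral_le_of_norm_le_const hbound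
  rw [entirePart, norm_mul]
  simp only [sub_zero, abs_one, mul_one] at this
  calc _ ≤ ‖z‖ * (Real.exp ‖z‖ * Real.exp ‖z‖ * M * 2 * (1 + ‖x‖) * Real.exp (‖z‖ * ‖x‖)) := by
        gcongr
    _ = _ := by ring

/-! ### The series in the explicit formula -/

theorem norm_neg_ofReal_mul_lt {r : ℝ} {z : ℂ} (hz : ‖z‖ < r) {s : ℝ} (hs : s ∈ Icc (0 : ℝ) 1) :
    ‖(s : ℂ) * -z‖ < r := by
  rw [mul_neg, norm_neg]; exact (norm_ofReal_mul_le hs z).trans_lt hz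

theorem hasSum_coeffC (z : ℂ) :
    HasSum (fun n : ℕ => (coeffC (n + 1) : ℂ) * z ^ (n + 1))
      (-z * ∫ s in (0 : ℝ)..1, expQuot (s * -z)) := by
  have h := ((hasExpansion_expQuot (‖z‖ + 1)).comp_mul (a := -1) (by simp)).integral z (by linarith)
  have h2 := h.mul_left (-z)
  have hf : ∀ s : ℝ, expQuot (-1 * (s * z)) = expQuot (s * -z) := fun s => by congr 1; ring
  simp only [hf] at h2
  refine h2.congr_fun fun n => ?_
  simp only [coeffC]
  push_cast
  rw [mul_comm ((n : ℂ) + 1), ← div_div]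
  ring

theorem entirePart_neg_one_eq_integral (z : ℂ) :
    entirePart (-z) 1 = z * ∫ s in (0 : ℝ)..1, Complex.exp (s * -z) * toddQuot (s * -z) := by
  rw [entirePart]
  have : ∀ s : ℝ, genKernel 1 (s * -z) = -(Complex.exp (s * -z) * toddQuot (s * -z)) := fun s => by
    simp [genKernel]
  simp only [this]
  rw [intervalIntegral.integral_neg]; ring

/-- Both sides are integrals of the derivative of `s ↦ -log (expQuot (-s z))` on `[0, 1]`. -/
theorem entirePart_neg_one_eq_log {z : ℂ} (hz : ‖z‖ < Real.pi) (h0 : z ≠ 0) :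
    entirePart (-z) 1 = Complex.log (z / (1 - Complex.exp (-z))) +
      -z * ∫ s in (0 : ℝ)..1, expQuot (s * -z) := by
  have hz2 : ‖z‖ < 2 * Real.pi := by linarith [Real.pi_pos]
  have hslit : ∀ s ∈ Icc (0 : ℝ) 1, expQuot (s * -z) ∈ slitPlane := fun s hs =>
    expQuot_mem_slitPlane ((Complex.abs_im_le_norm _).trans_lt (norm_neg_ofReal_mul_lt hz hs))
  have hlog : Complex.log (z / (1 - Complex.exp (-z))) = -Complex.log (expQuot (-z)) := by
    have h1 : expQuot (-z) ∈ slitPlane := by simpa using hslit 1 (by simp)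
    rw [← Complex.log_inv _ (Complex.slitPlane_arg_ne_pi h1), expQuot_of_ne (neg_ne_zero.2 h0), inv_div]
    congr 1
    rw [← neg_div_neg_eq]; ring_nf
  have hcont : ContinuousOn (fun s : ℝ => Complex.exp (s * -z) * toddQuot (s * -z)) (Icc 0 1) :=
    ContinuousOn.mul (by fun_prop) (continuousOn_toddQuot_ofReal_mul (by rwa [norm_neg]))
  have hcont2 : Continuous (fun s : ℝ => expQuot (s * -z)) :=
    continuous_expQuot.comp (by fun_prop)
  have hi1 : IntervalIntegrable (fun s : ℝ => Complex.exp (s * -z) * toddQuot (s * -z))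
      MeasureTheory.volume 0 1 := by
    apply ContinuousOn.intervalIntegrable
    rwa [uIcc_of_le zero_le_one]
  have hi2 : IntervalIntegrable (fun s : ℝ => expQuot (s * -z)) MeasureTheory.volume 0 1 :=
    hcont2.intervalIntegrable _ _
  have hftc := intervalIntegral.integral_eq_sub_of_hasDerivAt_of_le (a := 0) (b := 1)
    (f := fun s : ℝ => -Complex.log (expQuot (s * -z)))
    (f' := fun s : ℝ => z * (Complex.exp (s * -z) * toddQuot (s * -z) + expQuot (s * -z)))
    zero_le_one
    (fun s hs => (ContinuousAt.clog hcont2.continuousAt (hslit s hs)).neg.continuousWithinAt)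
    (fun s hs => by
      have hs' := Ioo_subset_Icc_self hs
      have hw0 := ofReal_mul_ne_zero hs (neg_ne_zero.2 h0)
      have hw := norm_neg_ofReal_mul_lt hz2 hs'
      have he := exp_sub_one_ne_zero hw hw0
      have hq := expQuot_ne_zero hw
      have hd : HasDerivAt expQuot (deriv expQuot (s * -z)) (s * -z) :=
        (differentiable_expQuot _).hasDerivAt
      have hd2 : HasDerivAt (fun u => u * expQuot u)
          (1 * expQuot (s * -z) + (s * -z) * deriv expQuot (s * -z)) (s * -z) :=
        (hasDerivAt_id _).mul hd
      have hd3 : HasDerivAt (fun u => u * expQuot u) (Complex.exp (s * -z)) (s * -z) := by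
        have : (fun u => u * expQuot u) = fun u => Complex.exp u - 1 := funext mul_expQuot
        rw [this]
        exact (Complex.hasDerivAt_exp _).sub_const 1
      have heq := hd2.unique hd3
      have hlin : HasDerivAt (fun s : ℝ => (s : ℂ) * -z) (1 * -z) s :=
        (Complex.ofRealCLM.hasDerivAt (x := s)).mul_const (-z)
      have hcomp : HasDerivAt (fun s : ℝ => expQuot (s * -z)) (deriv expQuot (s * -z) * (1 * -z)) s :=
        hd.comp s hlin
      refine (hcomp.clog_real (hslit s hs')).neg.congr_deriv ?_
      have hder : deriv expQuot (s * -z) = (Complex.exp (s * -z) - expQuot (s * -z)) / (s * -z) := by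
        rw [eq_div_iff hw0]; linear_combination heq
      rw [hder, toddQuot_of_ne hw0, expQuot_of_ne hw0]
      set w := (s : ℂ) * -z
      field_simp
      ring)
    ((hi1.add hi2).const_mul z)
  rw [intervalIntegral.integral_const_mul, intervalIntegral.integral_add hi1 hi2] at hftc
  rw [entirePart_neg_one_eq_integral, hlog]
  simp only [ofReal_one, one_mul, ofReal_zero, zero_mul, expQuot_zero, Complex.log_one] at hftc
  linear_combination hftc

theorem hasExpansion_coeffA : HasExpansion (2 * Real.pi) (fun k => (coeffA k : ℂ)) (fun z =>
    ∫ s in (0 : ℝ)..1, ((expQuot z - toddQuot z) - (expQuot (s * z) - toddQuot (s * z))) / (1 - s)) := by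
  intro z hz
  refine (((hasExpansion_expQuot _).sub hasExpansion_toddQuot).harmonic z hz).congr_fun fun k => ?_
  simp only [coeffA]
  rw [Nat.factorial_succ]
  have h1 : (k : ℂ) + 1 ≠ 0 := by exact_mod_cast Nat.succ_ne_zero k
  have h2 : (k.factorial : ℂ) ≠ 0 := by exact_mod_cast k.factorial_ne_zero
  push_cast
  field_simp

theorem hasExpansion_coeffB : HasExpansion (2 * Real.pi) (fun k => (coeffB k : ℂ)) (fun z =>
    toddQuot z * ∫ s in (0 : ℝ)..1, (Complex.exp z - Complex.exp (s * z)) / (1 - s)) := by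
  intro z hz
  refine ((hasExpansion_toddQuot.mul (hasExpansion_exp _).harmonic) z hz).congr_fun fun k => ?_
  congr 1
  beta_reduce
  rw [Finset.Nat.sum_antidiagonal_eq_sum_range_succ (fun i j =>
    ((bernoulli (i + 1) / (i + 1).factorial : ℚ) : ℂ) * (((1 / j.factorial : ℚ) : ℂ) * (harmonic j : ℂ)))]
  rw [coeffB, ← Finset.Ico_add_one_right_eq_Icc, Finset.sum_Ico_eq_sum_range]
  push_cast
  refine Finset.sum_congr (by simp) fun i hi => ?_
  have : k + 1 - (1 + i) = k - i := by omega
  rw [this, add_comm 1 i]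
  ring

theorem coeffA_zero : coeffA 0 = 0 := by simp [coeffA]

theorem coeffB_zero : coeffB 0 = 0 := by simp [coeffB]

theorem HasExpansion.hasSum_succ {r : ℝ} {c : ℕ → ℂ} {f : ℂ → ℂ} (h : HasExpansion r c f)
    (h0 : c 0 = 0) {z : ℂ} (hz : ‖z‖ < r) : HasSum (fun k => c (k + 1) * z ^ (k + 1)) (f z) := by
  simpa [h0] using (hasSum_nat_add_iff' 1).2 (h z hz)

theorem integral_exp_mul_genKernel {z w : ℂ} (hz0 : z ≠ 0) (hw0 : w ≠ 0) (hwz : w ≠ z)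
    (hw : ‖w‖ < 2 * Real.pi) :
    ∫ x in (1 : ℝ)..2, Complex.exp (-z * x) * genKernel x w =
      Complex.exp (w - z) * (Complex.exp (w - z) - 1) / ((w - z) * (1 - Complex.exp w)) +
        Complex.exp w / w * (Complex.exp (-z) * (1 - Complex.exp (-z)) / z) := by
  have he := exp_sub_one_ne_zero hw hw0
  have h5 : 1 - Complex.exp w ≠ 0 := by rw [← neg_sub]; exact neg_ne_zero.2 he
  have hwz' : w - z ≠ 0 := sub_ne_zero.2 hwz
  have h1 : ∀ x : ℝ, Complex.exp (-z * x) * genKernel x w =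
      Complex.exp ((w - z) * x) / (1 - Complex.exp w) +
        Complex.exp (-z * x) * (Complex.exp w / w) := by
    intro x
    have : Complex.exp ((w - z) * x) = Complex.exp (-z * x) * Complex.exp (x * w) := by
      rw [← Complex.exp_add]; ring_nf
    rw [genKernel_of_ne hw0 hw, this]; ring
  have hsq : ∀ a : ℂ, Complex.exp (a * (2 : ℝ)) = Complex.exp a * Complex.exp a := fun a => by
    rw [← Complex.exp_add]; push_cast; ring_nf
  simp only [h1]
  rw [intervalIntegral.integral_add, intervalIntegral.integral_div, intervalIntegral.integral_mul_const,
    integral_exp_mul_complex hwz', integral_exp_mul_complex (neg_ne_zero.2 hz0), hsq, hsq]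
  · simp only [ofReal_one, mul_one]
    field_simp
    ring
  · exact (by fun_prop : Continuous fun x : ℝ =>
      Complex.exp ((w - z) * x) / (1 - Complex.exp w)).intervalIntegrable _ _
  · exact (by fun_prop : Continuous fun x : ℝ =>
      Complex.exp (-z * x) * (Complex.exp w / w)).intervalIntegrable _ _

/-- The contribution of the entire part to `∑ e ^ (n z) log n` is the sum of the first two series of
the explicit formula. Both sides are integrals over `s ∈ [0, 1]`, the series by
`HasExpansion.harmonic`, and the integrands agree. -/
theorem sum_coeffA_coeffB_eq {z : ℂ} (hz : ‖z‖ < 2 * Real.pi) (h0 : z ≠ 0) {sA sB : ℂ}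
    (hA : HasSum (fun k => (coeffA (k + 1) : ℂ) * z ^ (k + 1)) sA)
    (hB : HasSum (fun k => (coeffB (k + 1) : ℂ) * z ^ (k + 1)) sB) :
    sA + sB = -(Complex.exp z / (1 - Complex.exp (-z))) *
      ∫ x in (1 : ℝ)..2, Complex.exp (-z * x) * entirePart z x := by
  have hA' := hasExpansion_coeffA.hasSum_succ (by simp [coeffA_zero]) hz
  have hB' := hasExpansion_coeffB.hasSum_succ (by simp [coeffB_zero]) hz
  rw [hA.unique hA', hB.unique hB']
  have h1 := (((hasExpansion_expQuot (2 * Real.pi)).sub hasExpansion_toddQuot).harmonic z hz).add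
    (((hasExpansion_exp (2 * Real.pi)).harmonic z hz).mul_left (toddQuot z))
  have h2 := (((hasExpansion_expQuot (2 * Real.pi)).sub hasExpansion_toddQuot).add
    ((hasExpansion_exp (2 * Real.pi)).const_mul (toddQuot z))).harmonic z hz
  have h3 := h1.unique (h2.congr_fun fun n => by ring)
  rw [h3, integral_mul_entirePart hz (by fun_prop : Continuous fun x : ℝ => Complex.exp (-z * x)),
    ← mul_assoc, ← intervalIntegral.integral_const_mul]
  refine intervalIntegral.integral_congr_Ioo_of_le zero_le_one fun s hs => ?_
  have hw0 := ofReal_mul_ne_zero hs h0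
  have hw := (norm_ofReal_mul_le (Ioo_subset_Icc_self hs) z).trans_lt hz
  have hs1 : (1 : ℂ) - s ≠ 0 := by
    rw [sub_ne_zero]; exact_mod_cast hs.2.ne'
  have hwz' : (s : ℂ) * z - z ≠ 0 := by
    have : (s : ℂ) * z - z = -((1 - s) * z) := by ring
    rw [this]; exact neg_ne_zero.2 (mul_ne_zero hs1 h0)
  have he := exp_sub_one_ne_zero hw hw0
  have hez := exp_sub_one_ne_zero hz h0
  have hs0 : (s : ℂ) ≠ 0 := by exact_mod_cast hs.1.ne'
  simp only [integral_exp_mul_genKernel h0 hw0 (sub_ne_zero.1 hwz') hw]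
  rw [expQuot_of_ne h0, expQuot_of_ne hw0, toddQuot_of_ne h0, toddQuot_of_ne hw0, Complex.exp_sub,
    Complex.exp_neg]
  have hE := Complex.exp_ne_zero z
  have hwz2 : (s : ℂ) * z - z = -((1 - s) * z) := by ring
  rw [hwz2]
  have h7 : 1 - Complex.exp (s * z) = -(Complex.exp (s * z) - 1) := by ring
  have h8 : 1 - (Complex.exp z)⁻¹ = (Complex.exp z - 1) / Complex.exp z := by field_simp
  rw [h7, h8]
  generalize Complex.exp (s * z) = A at *
  generalize Complex.exp z = B at *
  field_simp
  ring

/-! ### Primitives and growth on the right half-plane -/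


theorem eq_of_hasDerivAt_eq {s : Set ℂ} (hs : Convex ℝ s) {f g f' : ℂ → ℂ}
    (hf : ∀ x ∈ s, HasDerivAt f (f' x) x) (hg : ∀ x ∈ s, HasDerivAt g (f' x) x) {x₀ : ℂ}
    (hx₀ : x₀ ∈ s) (h : f x₀ = g x₀) {x : ℂ} (hx : x ∈ s) : f x = g x := by
  have := hs.norm_image_sub_le_of_norm_hasDerivWithin_le (f := fun x => f x - g x)
    (f' := fun _ => 0) (C := 0)
    (fun y hy => (((hf y hy).sub (hg y hy)).congr_deriv (sub_self _)).hasDerivWithinAt) (by simp) hx₀ hx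
  rw [h, sub_self, sub_zero, zero_mul] at this
  exact sub_eq_zero.1 (norm_le_zero_iff.1 this)

/-- A holomorphic function on the right half-plane has a primitive: the half-plane is the increasing
union of the discs with centre and radius `n`, and primitives normalised at `1` agree. -/
theorem exists_primitive {f : ℂ → ℂ} (hf : DifferentiableOn ℂ f {x | 0 < x.re}) :
    ∃ G : ℂ → ℂ, G 1 = 0 ∧ ∀ x : ℂ, 0 < x.re → HasDerivAt G (f x) x := by
  have hball : ∀ (n : ℕ) (x : ℂ), x ∈ Metric.ball (n : ℂ) n ↔ ‖x‖ ^ 2 < 2 * n * x.re := by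
    intro n x
    rw [Metric.mem_ball, dist_eq_norm, ← sq_lt_sq₀ (norm_nonneg _) (Nat.cast_nonneg n),
      ← Complex.normSq_eq_norm_sq, ← Complex.normSq_eq_norm_sq, Complex.normSq_apply,
      Complex.normSq_apply]
    simp only [sub_re, natCast_re, sub_im, natCast_im, sub_zero]
    constructor <;> intro h <;> nlinarith
  have hpos : ∀ (n : ℕ) (x : ℂ), x ∈ Metric.ball (n : ℂ) n → 0 < x.re := by
    intro n x hx
    rw [hball] at hx
    by_contra h
    push Not at h
    have : (0 : ℝ) ≤ n := Nat.cast_nonneg n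
    nlinarith [sq_nonneg ‖x‖]
  have hmono : ∀ {m n : ℕ} (x : ℂ), m ≤ n → x ∈ Metric.ball (m : ℂ) m →
      x ∈ Metric.ball (n : ℂ) n := by
    intro m n x hmn hx
    have hx0 := hpos m x hx
    rw [hball] at hx ⊢
    have : (m : ℝ) ≤ n := by exact_mod_cast hmn
    nlinarith
  have hone : ∀ {n : ℕ} (x : ℂ), x ∈ Metric.ball (n : ℂ) n → (1 : ℂ) ∈ Metric.ball (n : ℂ) n := by
    intro n x hx
    have hn : n ≠ 0 := by
      rintro rfl
      simp at hx
    have : (1 : ℝ) ≤ n := by exact_mod_cast Nat.one_le_iff_ne_zero.2 hn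
    rw [hball]
    simp; linarith
  have hprim : ∀ n : ℕ, ∃ g : ℂ → ℂ, g 1 = 0 ∧
      ∀ x ∈ Metric.ball (n : ℂ) n, HasDerivAt g (f x) x := fun n =>
    (DifferentiableOn.isExactOn_ball (hf.mono (hpos n))).with_val_at 1 0
  choose g hg1 hg using hprim
  have hagree : ∀ (m n : ℕ) (x : ℂ), x ∈ Metric.ball (m : ℂ) m → x ∈ Metric.ball (n : ℂ) n →
      g m x = g n x := by
    have : ∀ (m n : ℕ) (x : ℂ), m ≤ n → x ∈ Metric.ball (m : ℂ) m → g m x = g n x := by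
      intro m n x hmn hx
      exact eq_of_hasDerivAt_eq (convex_ball _ _) (hg m) (fun y hy => hg n y (hmono y hmn hy))
        (hone x hx) ((hg1 m).trans (hg1 n).symm) hx
    intro m n x hm hn
    rcases le_total m n with h | h
    · exact this m n x h hm
    · exact (this n m x h hn).symm
  have hex : ∀ x : ℂ, ∃ n : ℕ, 0 < x.re → x ∈ Metric.ball (n : ℂ) n := by
    intro x
    obtain ⟨n, hn⟩ := exists_nat_gt (‖x‖ ^ 2 / (2 * x.re))
    refine ⟨n, fun hx => ?_⟩
    rw [hball]
    rw [div_lt_iff₀ (by positivity)] at hn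
    linarith
  choose N hN using hex
  refine ⟨fun x => g (N x) x, hg1 _, fun x hx => ?_⟩
  refine (hg (N x) x (hN x hx)).congr_of_eventuallyEq ?_
  filter_upwards [Metric.isOpen_ball.mem_nhds (hN x hx)] with y hy
  exact hagree _ _ y (hN y (hpos _ y hy)) hy

theorem ExpTypeLT.of_norm_le {τ β K : ℝ} (hβ : β < τ) (hK : 0 ≤ K) {f : ℂ → ℂ}
    (hd : DifferentiableOn ℂ f {x | 0 < x.re})
    (hb : ∀ x : ℂ, 1 / 2 < x.re → ‖f x‖ ≤ K * (1 + ‖x‖) ^ 2 * Real.exp (β * ‖x‖)) :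
    ExpTypeLT τ f := by
  set δ := (τ - β) / 4 with hδ
  have hδ0 : 0 < δ := by rw [hδ]; linarith
  refine ⟨hd, 1 / 2, by norm_num, by norm_num, β + 2 * δ, by rw [hδ]; linarith,
    K * (1 + 1 / δ) ^ 2 + 1, by positivity, fun x hx => (hb x hx).trans ?_⟩
  have hx0 := norm_nonneg x
  have h1 : 1 + ‖x‖ ≤ (1 + 1 / δ) * Real.exp (δ * ‖x‖) := by
    calc 1 + ‖x‖ ≤ (1 + 1 / δ) * (δ * ‖x‖ + 1) := by
          have : (1 + 1 / δ) * (δ * ‖x‖ + 1) = 1 + ‖x‖ + δ * ‖x‖ + 1 / δ := by field_simp; ring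
          rw [this]
          have : 0 ≤ δ * ‖x‖ + 1 / δ := by positivity
          linarith
      _ ≤ _ := by gcongr; exact Real.add_one_le_exp _
  calc K * (1 + ‖x‖) ^ 2 * Real.exp (β * ‖x‖)
      ≤ K * ((1 + 1 / δ) * Real.exp (δ * ‖x‖)) ^ 2 * Real.exp (β * ‖x‖) := by gcongr
    _ = K * (1 + 1 / δ) ^ 2 * Real.exp ((β + 2 * δ) * ‖x‖) := by
        have : Real.exp ((β + 2 * δ) * ‖x‖) = Real.exp (δ * ‖x‖) ^ 2 * Real.exp (β * ‖x‖) := by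
          rw [← Real.exp_nat_mul, ← Real.exp_add]; push_cast; ring_nf
        rw [this]; ring
    _ ≤ _ := by gcongr; linarith

/-- If `G' = e ^ (-x z) V` with `V` of exponential type `‖z‖`, then `e ^ (x z) G` is of exponential
type `‖z‖` as well, and not only `2 ‖z‖`: on the segment from `1` to `x` the derivative of
`t ↦ e ^ (x z) G t` is `e ^ ((x - t) z) V t`, and `‖x - t‖ + ‖t - 1‖ = ‖x - 1‖` there. -/
theorem expTypeLT_exp_mul_primitive {τ : ℝ} {z : ℂ} (hz : ‖z‖ < τ) {V G : ℂ → ℂ} {K : ℝ} (hK : 0 ≤ K)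
    (hV : ∀ x : ℂ, 1 / 2 ≤ x.re → ‖V x‖ ≤ K * (1 + ‖x‖) * Real.exp (‖z‖ * ‖x‖))
    (hG1 : G 1 = 0)
    (hG : ∀ x : ℂ, 0 < x.re → HasDerivAt G (Complex.exp (-z * x) * V x) x) (C : ℂ) :
    ExpTypeLT τ (fun x => Complex.exp (x * z) * (C + G x)) := by
  refine ExpTypeLT.of_norm_le hz (K := ‖C‖ + 3 * K * Real.exp (2 * ‖z‖)) (by positivity) ?_ ?_
  · refine DifferentiableOn.mul (by fun_prop) (DifferentiableOn.const_add _ ?_)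
    exact fun x hx => (hG x hx).differentiableAt.differentiableWithinAt
  intro x hx
  have hx0 := norm_nonneg x
  have hx1 : ‖x - 1‖ ≤ 1 + ‖x‖ := by
    refine (norm_sub_le _ _).trans ?_
    rw [norm_one, add_comm]
  have hseg := (convex_segment (𝕜 := ℝ) (1 : ℂ) x).norm_image_sub_le_of_norm_hasDerivWithin_le
    (f := fun t => Complex.exp (x * z) * G t)
    (f' := fun t => Complex.exp (x * z) * (Complex.exp (-z * t) * V t))
    (C := 3 * K * (1 + ‖x‖) * Real.exp (‖z‖ * (2 + ‖x‖))) (x := 1) (y := x)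
    (by
      intro t ht
      obtain ⟨s, hs, rfl⟩ := (segment_eq_image' ℝ (1 : ℂ) x) ▸ ht
      refine ((hG _ ?_).const_mul _).hasDerivWithinAt
      simp
      nlinarith [hs.1, hs.2])
    (by
      intro t ht
      obtain ⟨s, hs, rfl⟩ := (segment_eq_image' ℝ (1 : ℂ) x) ▸ ht
      have hre : 1 / 2 ≤ (1 + s • (x - 1)).re := by
        simp
        nlinarith [hs.1, hs.2]
      have hn1 : ‖1 + s • (x - 1)‖ ≤ 1 + s * ‖x - 1‖ := by
        refine (norm_add_le _ _).trans ?_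
        rw [norm_one, norm_smul, Real.norm_eq_abs, abs_of_nonneg hs.1]
      have hn2 : ‖x - (1 + s • (x - 1))‖ ≤ (1 - s) * ‖x - 1‖ := by
        have : x - (1 + s • (x - 1)) = (1 - s) • (x - 1) := by
          rw [sub_smul, one_smul]; ring
        rw [this, norm_smul, Real.norm_eq_abs, abs_of_nonneg (by linarith [hs.2])]
      have hn3 : s * ‖x - 1‖ ≤ 1 + ‖x‖ :=
        (mul_le_of_le_one_left (norm_nonneg _) hs.2).trans hx1
      set t := 1 + s • (x - 1)
      have he : Complex.exp (x * z) * (Complex.exp (-z * t) * V t) =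
          Complex.exp (z * (x - t)) * V t := by
        rw [← mul_assoc, ← Complex.exp_add]; ring_nf
      rw [he, norm_mul]
      calc ‖Complex.exp (z * (x - t))‖ * ‖V t‖
          ≤ Real.exp (‖z‖ * ((1 - s) * ‖x - 1‖)) *
            (K * (1 + ‖t‖) * Real.exp (‖z‖ * (1 + s * ‖x - 1‖))) := by
            refine mul_le_mul ((Complex.norm_exp_le_exp_norm _).trans ?_) ((hV t hre).trans ?_)
              (norm_nonneg _) (Real.exp_pos _).le
            · rw [norm_mul]; gcongr
            · gcongr
        _ = K * (1 + ‖t‖) * Real.exp (‖z‖ * (1 + ‖x - 1‖)) := by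
            rw [mul_left_comm, ← Real.exp_add]; ring_nf
        _ ≤ K * (3 * (1 + ‖x‖)) * Real.exp (‖z‖ * (2 + ‖x‖)) := by
            have h1 : 1 + ‖t‖ ≤ 3 * (1 + ‖x‖) := by linarith
            have h2 : 1 + ‖x - 1‖ ≤ 2 + ‖x‖ := by linarith
            gcongr
        _ = _ := by ring)
    (left_mem_segment ℝ _ _) (right_mem_segment ℝ _ _)
  rw [hG1, mul_zero, sub_zero] at hseg
  rw [mul_add]
  have hexp : Real.exp (‖z‖ * (2 + ‖x‖)) = Real.exp (2 * ‖z‖) * Real.exp (‖z‖ * ‖x‖) := by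
    rw [← Real.exp_add]; ring_nf
  have hC : ‖Complex.exp (x * z) * C‖ ≤ ‖C‖ * (1 + ‖x‖) ^ 2 * Real.exp (‖z‖ * ‖x‖) := by
    rw [norm_mul, mul_comm]
    have h1 : ‖Complex.exp (x * z)‖ ≤ Real.exp (‖z‖ * ‖x‖) := by
      refine (Complex.norm_exp_le_exp_norm _).trans ?_
      rw [norm_mul, mul_comm]
    have h2 : 1 ≤ (1 + ‖x‖) ^ 2 := one_le_pow₀ (by linarith)
    gcongr
    exact le_mul_of_one_le_right (norm_nonneg _) h2
  calc _ ≤ _ := norm_add_le _ _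
    _ ≤ ‖C‖ * (1 + ‖x‖) ^ 2 * Real.exp (‖z‖ * ‖x‖) +
        3 * K * (1 + ‖x‖) * Real.exp (‖z‖ * (2 + ‖x‖)) * (1 + ‖x‖) := by
        refine add_le_add hC (hseg.trans ?_)
        gcongr
    _ = _ := by rw [hexp]; ring

/-! ### The remainders -/

theorem ne_zero_of_re_pos {x : ℂ} (hx : 0 < x.re) : x ≠ 0 := by
  rintro rfl; simp at hx

/-- The remainder of `e ^ (x z) / x`; for `z = 0` it is `-ψ`. -/
noncomputable def invRemainder (z x : ℂ) : ℂ :=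
  entirePart z x - harmonicPred x + Real.eulerMascheroniConstant

theorem differentiableOn_invRemainder {z : ℂ} (hz : ‖z‖ < 2 * Real.pi) :
    DifferentiableOn ℂ (invRemainder z) {x | 0 < x.re} :=
  ((differentiable_entirePart hz).differentiableOn.sub differentiableOn_harmonicPred).add_const _

theorem invRemainder_sub_add_one {z : ℂ} (hz : ‖z‖ < 2 * Real.pi) {x : ℂ} (hx : 0 < x.re) :
    invRemainder z x - invRemainder z (x + 1) = Complex.exp (x * z) / x := by
  have h := entirePart_sub_entirePart_add_one hz (ne_zero_of_re_pos hx)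
  rw [invRemainder, invRemainder, harmonicPred_add_one hx.le, harmonicPred]
  rw [sub_div] at h
  linear_combination h

theorem integral_invRemainder {z : ℂ} (hz : ‖z‖ < 2 * Real.pi) :
    ∫ x in (1 : ℝ)..2, invRemainder z x = 0 := by
  simp only [invRemainder]
  have h1 := intervalIntegrable_ofReal_of_differentiableOn
    (differentiable_entirePart hz).differentiableOn
  have h2 := intervalIntegrable_ofReal_of_differentiableOn differentiableOn_harmonicPred
  rw [intervalIntegral.integral_add (h1.sub h2) intervalIntegrable_const,
    intervalIntegral.integral_sub h1 h2, integral_entirePart hz, integral_harmonicPred,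
    intervalIntegral.integral_const, show (2 : ℝ) - 1 = 1 by norm_num, one_smul]
  ring

theorem exists_norm_invRemainder_le {z : ℂ} (hz : ‖z‖ < 2 * Real.pi) :
    ∃ K : ℝ, 0 ≤ K ∧ ∀ x : ℂ, 1 / 2 ≤ x.re →
      ‖invRemainder z x‖ ≤ K * (1 + ‖x‖) * Real.exp (‖z‖ * ‖x‖) := by
  obtain ⟨K, hK, hb⟩ := exists_norm_entirePart_le hz
  set γ := Real.eulerMascheroniConstant
  refine ⟨K + 2 + |γ|, by positivity, fun x hx => ?_⟩
  have hx0 := norm_nonneg x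
  have he : 1 ≤ Real.exp (‖z‖ * ‖x‖) := Real.one_le_exp (by positivity)
  have h1 : ‖harmonicPred x‖ ≤ 2 * (1 + ‖x‖) * Real.exp (‖z‖ * ‖x‖) :=
    (norm_harmonicPred_le hx).trans (le_mul_of_one_le_right (by positivity) he)
  have h2 : ‖(γ : ℂ)‖ ≤ |γ| * (1 + ‖x‖) * Real.exp (‖z‖ * ‖x‖) := by
    rw [Complex.norm_real, Real.norm_eq_abs]
    exact (le_mul_of_one_le_right (abs_nonneg _) (by linarith)).trans
      (le_mul_of_one_le_right (by positivity) he)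
  calc ‖invRemainder z x‖ ≤ ‖entirePart z x - harmonicPred x‖ + ‖(γ : ℂ)‖ := norm_add_le _ _
    _ ≤ ‖entirePart z x‖ + ‖harmonicPred x‖ + ‖(γ : ℂ)‖ := by gcongr; exact norm_sub_le _ _
    _ ≤ _ := by linarith [hb x]

theorem invRemainder_one (z : ℂ) :
    invRemainder z 1 = entirePart z 1 + Real.eulerMascheroniConstant := by
  rw [invRemainder, harmonicPred_one, sub_zero]

theorem expTypeLT_invRemainder {z : ℂ} (hz : ‖z‖ < 2 * Real.pi) :
    ExpTypeLT (2 * Real.pi) (invRemainder z) := by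
  obtain ⟨K, hK, hb⟩ := exists_norm_invRemainder_le hz
  refine ExpTypeLT.of_norm_le hz hK (differentiableOn_invRemainder hz) fun x hx => ?_
  refine (hb x hx.le).trans ?_
  have hx0 := norm_nonneg x
  gcongr
  nlinarith

theorem differentiableOn_log : DifferentiableOn ℂ Complex.log {x | 0 < x.re} := fun _ hx =>
  (Complex.differentiableAt_log (Or.inl hx)).differentiableWithinAt

theorem expTypeLT_exp_mul_log {z : ℂ} (hz : ‖z‖ < Real.pi) :
    ExpTypeLT Real.pi (fun x => Complex.exp (x * z) * Complex.log x) := by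
  refine ExpTypeLT.of_norm_le hz (K := 5) (by norm_num) ?_ fun x hx => ?_
  · exact DifferentiableOn.mul (by fun_prop) differentiableOn_log
  have hx0 := norm_nonneg x
  have hx2 : 1 / 2 < ‖x‖ := hx.trans_le (Complex.re_le_norm x)
  have hlog : ‖Complex.log x‖ ≤ 5 * (1 + ‖x‖) := by
    refine (Complex.norm_le_abs_re_add_abs_im _).trans ?_
    rw [Complex.log_re, Complex.log_im]
    have h1 := Complex.abs_arg_le_pi x
    have h2 : |Real.log ‖x‖| ≤ 1 + ‖x‖ := by
      rw [abs_le]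
      constructor
      · have h3 := Real.one_sub_inv_le_log_of_pos (by linarith : 0 < ‖x‖)
        have h4 : ‖x‖⁻¹ ≤ 2 := by
          rw [inv_le_comm₀ (by linarith) two_pos]; linarith
        linarith
      · have := Real.log_le_sub_one_of_pos (by linarith : 0 < ‖x‖)
        linarith
    linarith [Real.pi_lt_four]
  rw [norm_mul]
  have h1 : ‖Complex.exp (x * z)‖ ≤ Real.exp (‖z‖ * ‖x‖) := by
    refine (Complex.norm_exp_le_exp_norm _).trans ?_
    rw [norm_mul, mul_comm]
  calc _ ≤ Real.exp (‖z‖ * ‖x‖) * (5 * (1 + ‖x‖)) :=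
        mul_le_mul h1 hlog (norm_nonneg _) (Real.exp_pos _).le
    _ ≤ Real.exp (‖z‖ * ‖x‖) * (5 * (1 + ‖x‖) ^ 2) := by gcongr; nlinarith
    _ = _ := by ring

/-- Every solution `R` of `R' - z R = V`, with `V` the remainder of `e ^ (x z) / x`, solves the
difference equation of `e ^ (x z) log x` as soon as `R 1 = R 2`: the derivative of
`e ^ (-x z) (R x - R (x + 1))` is `1 / x`. -/
theorem exp_mul_primitive_sub_add_one {z : ℂ} (hz : ‖z‖ < 2 * Real.pi) {G : ℂ → ℂ} (hG1 : G 1 = 0)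
    (hG : ∀ x : ℂ, 0 < x.re → HasDerivAt G (Complex.exp (-z * x) * invRemainder z x) x) {C : ℂ}
    (hC : C = Complex.exp z * (C + G 2)) {x : ℂ} (hx : 0 < x.re) :
    Complex.exp (x * z) * (C + G x) - Complex.exp ((x + 1) * z) * (C + G (x + 1)) =
      Complex.exp (x * z) * Complex.log x := by
  have hD : ∀ y ∈ {x : ℂ | 0 < x.re},
      HasDerivAt (fun y => C + G y - Complex.exp z * (C + G (y + 1))) y⁻¹ y := by
    intro y hy
    have hy1 : 0 < (y + 1).re := by
      have : 0 < y.re := hy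
      simp; linarith
    have h2 := ((hG (y + 1) hy1).comp_add_const y 1).const_add C |>.const_mul (Complex.exp z)
    refine (((hG y hy).const_add C).sub h2).congr_deriv ?_
    have h3 := invRemainder_sub_add_one hz hy
    have h4 : Complex.exp z * Complex.exp (-z * (y + 1)) = Complex.exp (-z * y) := by
      rw [← Complex.exp_add]; ring_nf
    have h5 : Complex.exp (-z * y) * Complex.exp (y * z) = 1 := by
      rw [← Complex.exp_add]; ring_nf; simp
    rw [← mul_assoc, h4, ← mul_sub, h3, mul_div_assoc', h5, one_div]
  have key := eq_of_hasDerivAt_eq (convex_halfSpace_re_gt 0) hD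
    (fun y hy => Complex.hasDerivAt_log (Or.inl hy)) (x₀ := 1) (by simp)
    (by
      rw [Complex.log_one, hG1, one_add_one_eq_two, add_zero, ← hC, sub_self]) hx
  have h6 : Complex.exp ((x + 1) * z) = Complex.exp (x * z) * Complex.exp z := by
    rw [← Complex.exp_add]; ring_nf
  rw [h6]
  linear_combination Complex.exp (x * z) * key

theorem exp_mul_log_natCast (z : ℂ) (n : ℕ) :
    Complex.exp (n * z) * Complex.log n = logTerm z n := by
  rw [logTerm, Complex.natCast_log]

theorem integral_deriv_eq_sub {f f' : ℂ → ℂ} (hf : ∀ x : ℂ, 0 < x.re → HasDerivAt f (f' x) x)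
    (hf' : IntervalIntegrable (fun t : ℝ => f' t) MeasureTheory.volume 1 2) :
    ∫ t in (1 : ℝ)..2, f' t = f 2 - f 1 := by
  have := intervalIntegral.integral_eq_sub_of_hasDerivAt (a := 1) (b := 2)
    (f := fun t : ℝ => f t) (f' := fun t : ℝ => f' t)
    (fun t ht => (hf t (by
      rw [uIcc_of_le (by norm_num)] at ht
      simp; linarith [ht.1])).comp_ofReal) hf'
  simpa using this

theorem one_sub_exp_neg_ne_zero {z : ℂ} (hz : ‖z‖ < 2 * Real.pi) (h0 : z ≠ 0) :
    1 - Complex.exp (-z) ≠ 0 := by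
  rw [← neg_sub]
  exact neg_ne_zero.2 (exp_sub_one_ne_zero (by rwa [norm_neg]) (neg_ne_zero.2 h0))

theorem hasRamanujanSum_logTerm {z : ℂ} (hz : ‖z‖ < Real.pi) (h0 : z ≠ 0) :
    HasRamanujanSum (logTerm z) (-(Complex.exp z / (1 - Complex.exp (-z))) *
      ∫ x in (1 : ℝ)..2, Complex.exp (-z * x) * invRemainder z x) := by
  have hz2 : ‖z‖ < 2 * Real.pi := by linarith [Real.pi_pos]
  have hVd := differentiableOn_invRemainder hz2
  have hfd : DifferentiableOn ℂ (fun x => Complex.exp (-z * x) * invRemainder z x) {x | 0 < x.re} :=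
    DifferentiableOn.mul (by fun_prop) hVd
  obtain ⟨G, hG1, hG⟩ := exists_primitive hfd
  obtain ⟨K, hK, hV⟩ := exists_norm_invRemainder_le hz2
  have hI := integral_deriv_eq_sub hG (intervalIntegrable_ofReal_of_differentiableOn hfd)
  rw [hG1, sub_zero] at hI
  rw [hI]
  have he := exp_sub_one_ne_zero hz2 h0
  have hE := Complex.exp_ne_zero z
  -- the value of the constant for which `R 1 = R 2`
  set C : ℂ := -(Complex.exp z * G 2 / (Complex.exp z - 1)) with hCdef
  have hC : C = Complex.exp z * (C + G 2) := by
    rw [hCdef]; field_simp; ring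
  have hRtype := expTypeLT_exp_mul_primitive hz2 hK hV hG1 hG C
  have hRder : ∀ x : ℂ, 0 < x.re → HasDerivAt (fun x => Complex.exp (x * z) * (C + G x))
      (z * (Complex.exp (x * z) * (C + G x)) + invRemainder z x) x := by
    intro x hx
    have h1 : HasDerivAt (fun x => Complex.exp (x * z)) (Complex.exp (x * z) * (1 * z)) x :=
      ((hasDerivAt_id x).mul_const z).cexp
    refine (h1.mul ((hG x hx).const_add C)).congr_deriv ?_
    have h5 : Complex.exp (x * z) * Complex.exp (-z * x) = 1 := by
      rw [← Complex.exp_add]; ring_nf; simp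
    linear_combination (invRemainder z x) * h5
  refine ⟨_, fun x => Complex.exp (x * z) * (C + G x), expTypeLT_exp_mul_log hz,
    fun n _ => exp_mul_log_natCast z n,
    ⟨hRtype, fun x hx => exp_mul_primitive_sub_add_one hz2 hG1 hG hC hx, ?_⟩, ?_⟩
  · have i1 := intervalIntegrable_ofReal_of_differentiableOn hRtype.1
    have i2 := intervalIntegrable_ofReal_of_differentiableOn hVd
    have h := integral_deriv_eq_sub hRder ((i1.const_mul z).add i2)
    rw [intervalIntegral.integral_add (i1.const_mul z) i2, intervalIntegral.integral_const_mul,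
      integral_invRemainder hz2, add_zero, hG1, add_zero, one_mul] at h
    have h2 : Complex.exp (2 * z) = Complex.exp z * Complex.exp z := by
      rw [← Complex.exp_add]; ring_nf
    rw [h2, mul_assoc, ← hC, sub_self] at h
    exact (mul_eq_zero.1 h).resolve_left h0
  · simp only [hG1, one_mul, add_zero]
    have hne := one_sub_exp_neg_ne_zero hz2 h0
    rw [hCdef]
    have : 1 - Complex.exp (-z) = (Complex.exp z - 1) / Complex.exp z := by
      rw [Complex.exp_neg]; field_simp
    rw [this]
    field_simp

theorem entirePart_zero (x : ℂ) : entirePart 0 x = 0 := by simp [entirePart]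

/-- At `z = 0` the condition `R 1 = R 2` holds for every constant `C`, which is determined by
`∫₁² R = 0` instead. -/
theorem hasRamanujanSum_logTerm_zero :
    HasRamanujanSum (logTerm 0) (∫ x in (1 : ℝ)..2, (x : ℂ) * invRemainder 0 x) := by
  have hz : ‖(0 : ℂ)‖ < Real.pi := by simpa using Real.pi_pos
  have hz2 : ‖(0 : ℂ)‖ < 2 * Real.pi := by simpa using Real.pi_pos
  have hVd := differentiableOn_invRemainder hz2
  have hfd : DifferentiableOn ℂ (fun x => Complex.exp (-0 * x) * invRemainder 0 x) {x | 0 < x.re} :=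
    DifferentiableOn.mul (by fun_prop) hVd
  obtain ⟨G, hG1, hG⟩ := exists_primitive hfd
  obtain ⟨K, hK, hV⟩ := exists_norm_invRemainder_le hz2
  have hI := integral_deriv_eq_sub hG (intervalIntegrable_ofReal_of_differentiableOn hfd)
  simp only [neg_zero, zero_mul, Complex.exp_zero, one_mul] at hI
  rw [integral_invRemainder hz2, hG1, sub_zero] at hI
  set C : ℂ := ∫ x in (1 : ℝ)..2, (x : ℂ) * invRemainder 0 x with hCdef
  have hC : C = Complex.exp 0 * (C + G 2) := by rw [← hI]; simp
  have hRtype := expTypeLT_exp_mul_primitive hz2 hK hV hG1 hG C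
  refine ⟨_, fun x => Complex.exp (x * 0) * (C + G x), expTypeLT_exp_mul_log hz,
    fun n _ => exp_mul_log_natCast 0 n,
    ⟨hRtype, fun x hx => exp_mul_primitive_sub_add_one hz2 hG1 hG hC hx, ?_⟩, ?_⟩
  · have hGd : DifferentiableOn ℂ G {x | 0 < x.re} := fun x hx =>
      (hG x hx).differentiableAt.differentiableWithinAt
    have i1 := intervalIntegrable_ofReal_of_differentiableOn hGd
    have hxV : DifferentiableOn ℂ (fun x => x * invRemainder 0 x) {x | 0 < x.re} :=
      differentiableOn_id.mul hVd
    have i2 := intervalIntegrable_ofReal_of_differentiableOn hxV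
    -- integration by parts: `(x G)' = G + x V`
    have h := integral_deriv_eq_sub (f := fun x => x * G x) (f' := fun x => G x + x * invRemainder 0 x)
      (fun x hx => ((hasDerivAt_id x).mul (hG x hx)).congr_deriv (by simp)) (i1.add i2)
    rw [intervalIntegral.integral_add i1 i2, ← hI, hG1] at h
    simp only [mul_zero, Complex.exp_zero, one_mul]
    rw [intervalIntegral.integral_add intervalIntegrable_const i1, intervalIntegral.integral_const,
      show (2 : ℝ) - 1 = 1 by norm_num, one_smul]
    linear_combination h
  · simp [hG1]

theorem exp_mul_harmonicFun_natCast (z : ℂ) (n : ℕ) :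
    Complex.exp (-(n * z)) * harmonicFun n = harmonicTerm z n := by
  rw [harmonicTerm, harmonicFun_natCast]

theorem norm_exp_neg_mul_le (z x : ℂ) : ‖Complex.exp (-(x * z))‖ ≤ Real.exp (‖z‖ * ‖x‖) := by
  refine (Complex.norm_exp_le_exp_norm _).trans ?_
  rw [norm_neg, norm_mul, mul_comm]

theorem expTypeLT_exp_mul_harmonicFun {z : ℂ} (hz : ‖z‖ < Real.pi) :
    ExpTypeLT Real.pi (fun x => Complex.exp (-(x * z)) * harmonicFun x) := by
  refine ExpTypeLT.of_norm_le hz (K := 2) (by norm_num) ?_ fun x hx => ?_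
  · exact DifferentiableOn.mul (by fun_prop) differentiableOn_harmonicFun
  have hx0 := norm_nonneg x
  rw [norm_mul]
  calc _ ≤ Real.exp (‖z‖ * ‖x‖) * (2 * ‖x‖) :=
        mul_le_mul (norm_exp_neg_mul_le z x) (norm_harmonicFun_le (by linarith)) (norm_nonneg _)
          (Real.exp_pos _).le
    _ ≤ Real.exp (‖z‖ * ‖x‖) * (2 * (1 + ‖x‖) ^ 2) := by gcongr; nlinarith
    _ = _ := by ring

theorem differentiableOn_exp_mul_harmonicPred (z : ℂ) :
    DifferentiableOn ℂ (fun x => Complex.exp (-z * x) * harmonicPred x) {x | 0 < x.re} :=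
  DifferentiableOn.mul (by fun_prop) differentiableOn_harmonicPred

theorem expTypeLT_exp_mul_harmonicPred {z : ℂ} {τ : ℝ} (hz : ‖z‖ < τ) :
    ExpTypeLT τ (fun x => Complex.exp (-z * x) * harmonicPred x) := by
  refine ExpTypeLT.of_norm_le hz (K := 2) (by norm_num) (differentiableOn_exp_mul_harmonicPred z)
    fun x hx => ?_
  have hx0 := norm_nonneg x
  have h : Complex.exp (-z * x) = Complex.exp (-(x * z)) := by ring_nf
  rw [norm_mul, h]
  calc _ ≤ Real.exp (‖z‖ * ‖x‖) * (2 * (1 + ‖x‖)) :=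
        mul_le_mul (norm_exp_neg_mul_le z x) (norm_harmonicPred_le hx.le) (norm_nonneg _)
          (Real.exp_pos _).le
    _ ≤ Real.exp (‖z‖ * ‖x‖) * (2 * (1 + ‖x‖) ^ 2) := by gcongr; nlinarith
    _ = _ := by ring

theorem expTypeLT_const {τ : ℝ} (hτ : 0 < τ) (a : ℂ) : ExpTypeLT τ (fun _ => a) := by
  refine ExpTypeLT.of_norm_le hτ (norm_nonneg a) (by fun_prop) fun x _ => ?_
  rw [zero_mul, Real.exp_zero, mul_one]
  exact le_mul_of_one_le_right (norm_nonneg _) (one_le_pow₀ (by linarith [norm_nonneg x]))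

/-- Summation by parts: `(1 - e ^ (-z)) e ^ (-x z) H_x` is the difference of `e ^ (-x z) H_{x - 1}`
plus `e ^ (-x z) / x`. -/
theorem hasRamanujanSum_harmonicTerm {z : ℂ} (hz : ‖z‖ < Real.pi) (h0 : z ≠ 0) :
    HasRamanujanSum (harmonicTerm z) ((1 - Complex.exp (-z))⁻¹ * (invRemainder (-z) 1 -
      ∫ x in (1 : ℝ)..2, Complex.exp (-z * x) * harmonicPred x)) := by
  have hz2 : ‖z‖ < 2 * Real.pi := by linarith [Real.pi_pos]
  have hz3 : ‖-z‖ < 2 * Real.pi := by rwa [norm_neg]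
  have hne := one_sub_exp_neg_ne_zero hz2 h0
  set c : ℂ := ∫ x in (1 : ℝ)..2, Complex.exp (-z * x) * harmonicPred x with hc
  refine ⟨_, fun x => (1 - Complex.exp (-z))⁻¹ * (Complex.exp (-z * x) * harmonicPred x +
      invRemainder (-z) x - c), expTypeLT_exp_mul_harmonicFun hz,
    fun n _ => exp_mul_harmonicFun_natCast z n,
    ⟨?_, fun x hx => ?_, ?_⟩, ?_⟩
  · exact (((expTypeLT_exp_mul_harmonicPred hz2).add (expTypeLT_invRemainder hz3)).sub
      (expTypeLT_const (by positivity) c)).const_mul _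
  · have h1 := invRemainder_sub_add_one hz3 hx
    have hx0 := ne_zero_of_re_pos hx
    have h2 : Complex.exp (-z * (x + 1)) = Complex.exp (-z * x) * Complex.exp (-z) := by
      rw [← Complex.exp_add]; ring_nf
    have h3 : Complex.exp (x * -z) = Complex.exp (-z * x) := by ring_nf
    have h4 : Complex.exp (-(x * z)) = Complex.exp (-z * x) := by ring_nf
    rw [h3] at h1
    beta_reduce
    rw [← mul_sub, inv_mul_eq_iff_eq_mul₀ hne, harmonicPred_add_one hx.le, h2, h4, harmonicPred]
    linear_combination h1
  · have i1 := intervalIntegrable_ofReal_of_differentiableOn (differentiableOn_exp_mul_harmonicPred z)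
    have i2 := intervalIntegrable_ofReal_of_differentiableOn (differentiableOn_invRemainder hz3)
    rw [intervalIntegral.integral_const_mul, intervalIntegral.integral_sub (i1.add i2)
      intervalIntegrable_const, intervalIntegral.integral_add i1 i2, integral_invRemainder hz3,
      intervalIntegral.integral_const, show (2 : ℝ) - 1 = 1 by norm_num, one_smul, ← hc]
    ring
  · simp only [harmonicPred_one]
    ring

/-- At `z = 0` the summation by parts reads `R x = x - x H_{x - 1} + c`. -/
theorem hasRamanujanSum_harmonicTerm_zero :
    HasRamanujanSum (harmonicTerm 0) ((∫ x in (1 : ℝ)..2, (x : ℂ) * harmonicPred x) - 1 / 2) := by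
  have hz : ‖(0 : ℂ)‖ < Real.pi := by simpa using Real.pi_pos
  have hxd : DifferentiableOn ℂ (fun x => x * harmonicPred x) {x | 0 < x.re} :=
    differentiableOn_id.mul differentiableOn_harmonicPred
  set c : ℂ := ∫ x in (1 : ℝ)..2, (x : ℂ) * harmonicPred x with hc
  refine ⟨_, fun x => x - x * harmonicPred x + (c - 3 / 2), expTypeLT_exp_mul_harmonicFun hz,
    fun n _ => exp_mul_harmonicFun_natCast 0 n,
    ⟨?_, fun x hx => ?_, ?_⟩, ?_⟩
  · refine ExpTypeLT.of_norm_le (K := 3 + ‖c - 3 / 2‖) (by positivity : (0 : ℝ) < 2 * Real.pi)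
      (by positivity) ((differentiableOn_id.sub hxd).add_const _) fun x hx => ?_
    have hx0 := norm_nonneg x
    have h1 := norm_harmonicPred_le hx.le
    have h2 : ‖x - x * harmonicPred x + (c - 3 / 2)‖ ≤
        ‖x‖ + ‖x‖ * (2 * (1 + ‖x‖)) + ‖c - 3 / 2‖ := by
      refine (norm_add_le _ _).trans ?_
      gcongr
      refine (norm_sub_le _ _).trans ?_
      rw [norm_mul]
      gcongr
    refine h2.trans ?_
    rw [zero_mul, Real.exp_zero, mul_one, add_mul]
    have h3 : ‖c - 3 / 2‖ ≤ ‖c - 3 / 2‖ * (1 + ‖x‖) ^ 2 :=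
      le_mul_of_one_le_right (norm_nonneg _) (one_le_pow₀ (by linarith))
    nlinarith
  · have hx0 := ne_zero_of_re_pos hx
    beta_reduce
    rw [harmonicPred_add_one hx.le, harmonicPred]
    simp only [mul_zero, neg_zero, Complex.exp_zero, one_mul]
    field_simp
    ring
  · have i1 := intervalIntegrable_ofReal_of_differentiableOn hxd
    have i0 : IntervalIntegrable (fun t : ℝ => (t : ℂ)) MeasureTheory.volume 1 2 :=
      Complex.continuous_ofReal.intervalIntegrable _ _
    have hid : ∫ t in (1 : ℝ)..2, (t : ℂ) = 3 / 2 := by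
      rw [intervalIntegral.integral_ofReal, integral_id]; norm_num
    rw [intervalIntegral.integral_add (i0.sub i1) intervalIntegrable_const,
      intervalIntegral.integral_sub i0 i1, hid,
      intervalIntegral.integral_const, show (2 : ℝ) - 1 = 1 by norm_num, one_smul, ← hc]
    ring
  · simp only [harmonicPred_one]
    ring

/-! ### The formula -/

theorem integral_exp_mul_invRemainder {z : ℂ} (hz : ‖z‖ < 2 * Real.pi) (h0 : z ≠ 0) :
    ∫ x in (1 : ℝ)..2, Complex.exp (-z * x) * invRemainder z x =
      (∫ x in (1 : ℝ)..2, Complex.exp (-z * x) * entirePart z x) -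
      (∫ x in (1 : ℝ)..2, Complex.exp (-z * x) * harmonicPred x) +
      Real.eulerMascheroniConstant * (Complex.exp (-z) * (1 - Complex.exp (-z)) / z) := by
  have i1 : IntervalIntegrable (fun x : ℝ => Complex.exp (-z * x) * entirePart z x)
      MeasureTheory.volume 1 2 :=
    intervalIntegrable_ofReal_of_differentiableOn (p := fun x => Complex.exp (-z * x) * entirePart z x)
      (DifferentiableOn.mul (by fun_prop) (differentiable_entirePart hz).differentiableOn)
  have i2 := intervalIntegrable_ofReal_of_differentiableOn (differentiableOn_exp_mul_harmonicPred z)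
  have i3 : IntervalIntegrable (fun x : ℝ => Complex.exp (-z * x) * Real.eulerMascheroniConstant)
      MeasureTheory.volume 1 2 :=
    (by fun_prop : Continuous fun x : ℝ =>
      Complex.exp (-z * x) * (Real.eulerMascheroniConstant : ℂ)).intervalIntegrable _ _
  simp only [invRemainder, mul_add, mul_sub]
  rw [intervalIntegral.integral_add (i1.sub i2) i3, intervalIntegral.integral_sub i1 i2,
    intervalIntegral.integral_mul_const, integral_exp_mul_complex (neg_ne_zero.2 h0)]
  have hsq : Complex.exp (-z * (2 : ℝ)) = Complex.exp (-z) * Complex.exp (-z) := by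
    rw [← Complex.exp_add]; push_cast; ring_nf
  rw [hsq]
  simp only [ofReal_one, mul_one]
  field_simp
  ring

theorem ramanujanSum_add_eq {z : ℂ} (hz : ‖z‖ < Real.pi) (h0 : z ≠ 0) {sA sB : ℂ}
    (hA : HasSum (fun k => (coeffA (k + 1) : ℂ) * z ^ (k + 1)) sA)
    (hB : HasSum (fun k => (coeffB (k + 1) : ℂ) * z ^ (k + 1)) sB) :
    ramanujanSum (logTerm z) + Complex.exp z * ramanujanSum (harmonicTerm z) =
      (Real.eulerMascheroniConstant : ℂ) * (Complex.exp z / (1 - Complex.exp (-z)) - 1 / z) + sA + sB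
        + Complex.exp z / (1 - Complex.exp (-z)) * entirePart (-z) 1 := by
  have hz2 : ‖z‖ < 2 * Real.pi := by linarith [Real.pi_pos]
  have hne := one_sub_exp_neg_ne_zero hz2 h0
  have hAB := sum_coeffA_coeffB_eq hz2 h0 hA hB
  have hE : Complex.exp z * Complex.exp (-z) = 1 := by rw [← Complex.exp_add]; simp
  rw [(hasRamanujanSum_logTerm hz h0).ramanujanSum_eq,
    (hasRamanujanSum_harmonicTerm hz h0).ramanujanSum_eq, integral_exp_mul_invRemainder hz2 h0,
    invRemainder_one, add_assoc _ sA sB, hAB]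
  have h1 : Complex.exp z / (1 - Complex.exp (-z)) * (Real.eulerMascheroniConstant *
      (Complex.exp (-z) * (1 - Complex.exp (-z)) / z)) = Real.eulerMascheroniConstant * (1 / z) := by
    calc _ = (Complex.exp z * Complex.exp (-z)) * Real.eulerMascheroniConstant * (1 / z) := by
          field_simp
      _ = _ := by rw [hE, one_mul]
  rw [mul_add, neg_mul _ (_ * (_ / z)), h1]
  rw [div_eq_mul_inv (Complex.exp z)]
  ring

/-- The value at `z = 0`; its rational part `-1 / 2` is the constant term of the power series `q`. -/
theorem ramanujanSum_add_eq_zero :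
    ramanujanSum (logTerm 0) + Complex.exp 0 * ramanujanSum (harmonicTerm 0) =
      (Real.eulerMascheroniConstant : ℂ) * (3 / 2) - 1 / 2 := by
  rw [hasRamanujanSum_logTerm_zero.ramanujanSum_eq,
    hasRamanujanSum_harmonicTerm_zero.ramanujanSum_eq, Complex.exp_zero, one_mul]
  have i1 : IntervalIntegrable (fun x : ℝ => (x : ℂ) * harmonicPred x) MeasureTheory.volume 1 2 :=
    intervalIntegrable_ofReal_of_differentiableOn (p := fun x => x * harmonicPred x)
      (differentiableOn_id.mul differentiableOn_harmonicPred)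
  have h : ∀ x : ℝ, (x : ℂ) * invRemainder 0 x =
      x * Real.eulerMascheroniConstant - x * harmonicPred x := by
    intro x
    rw [invRemainder, entirePart_zero]; ring
  have hid : ∫ t in (1 : ℝ)..2, (t : ℂ) = 3 / 2 := by
    rw [intervalIntegral.integral_ofReal, integral_id]; norm_num
  simp only [h]
  rw [intervalIntegral.integral_sub _ i1, intervalIntegral.integral_mul_const, hid]
  · ring
  · exact (by fun_prop : Continuous fun x : ℝ =>
      (x : ℂ) * (Real.eulerMascheroniConstant : ℂ)).intervalIntegrable _ _

/-- `f` is the sum on the disc `‖z‖ < r` of a power series with rational coefficients. -/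
def HasRationalExpansion (r : ℝ) (f : ℂ → ℂ) : Prop :=
  ∃ q : ℕ → ℚ, HasExpansion r (fun n => (q n : ℂ)) f

theorem HasRationalExpansion.add {r : ℝ} {f g : ℂ → ℂ} (hf : HasRationalExpansion r f)
    (hg : HasRationalExpansion r g) : HasRationalExpansion r (fun z => f z + g z) := by
  obtain ⟨p, hp⟩ := hf
  obtain ⟨q, hq⟩ := hg
  exact ⟨fun n => p n + q n, by simpa using hp.add hq⟩

theorem HasRationalExpansion.mul {r : ℝ} {f g : ℂ → ℂ} (hf : HasRationalExpansion r f)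
    (hg : HasRationalExpansion r g) : HasRationalExpansion r (fun z => f z * g z) := by
  obtain ⟨p, hp⟩ := hf
  obtain ⟨q, hq⟩ := hg
  exact ⟨fun n => ∑ k ∈ Finset.HasAntidiagonal.antidiagonal n, p k.1 * q k.2,
    by simpa using hp.mul hq⟩

theorem HasRationalExpansion.comp_neg {r : ℝ} {f : ℂ → ℂ} (hf : HasRationalExpansion r f) :
    HasRationalExpansion r (fun z => f (-z)) := by
  obtain ⟨q, hq⟩ := hf
  exact ⟨fun n => q n * (-1) ^ n, by simpa using hq.comp_mul (a := -1) (by simp)⟩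

theorem HasRationalExpansion.integral {r : ℝ} {f : ℂ → ℂ} (hf : HasRationalExpansion r f) :
    HasRationalExpansion r (fun z => ∫ s in (0 : ℝ)..1, f (s * z)) := by
  obtain ⟨q, hq⟩ := hf
  exact ⟨fun n => q n / (n + 1), by simpa using hq.integral⟩

theorem hasRationalExpansion_entirePart : HasRationalExpansion (2 * Real.pi)
    (fun z => ∫ s in (0 : ℝ)..1, Complex.exp (s * -z) * toddQuot (s * -z)) := by
  have h := (HasRationalExpansion.mul ⟨_, hasExpansion_exp (2 * Real.pi)⟩
    ⟨_, hasExpansion_toddQuot⟩).integral.comp_neg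
  exact h

theorem toddQuot_zero : toddQuot 0 = -1 / 2 := by
  rw [hasExpansion_toddQuot.apply_zero (by positivity)]
  norm_num [bernoulli_one]

theorem exists_rational_series :
    ∃ q : PowerSeries ℚ, ∀ z : ℂ, ‖z‖ < Real.pi →
      HasSum (fun k : ℕ => ((PowerSeries.coeff k q : ℚ) : ℂ) * z ^ k)
        (ramanujanSum (logTerm z) + Complex.exp z * ramanujanSum (harmonicTerm z)
          - (Real.eulerMascheroniConstant : ℂ) * gammaFactor z) := by
  have hexp : HasRationalExpansion (2 * Real.pi) Complex.exp := ⟨_, hasExpansion_exp _⟩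
  have h := ((HasRationalExpansion.add ⟨_, hasExpansion_coeffA⟩ ⟨_, hasExpansion_coeffB⟩).add
    (((hexp.mul hexp).mul ⟨_, hasExpansion_todd⟩).mul hasRationalExpansion_entirePart))
  obtain ⟨q, hq⟩ := h
  refine ⟨PowerSeries.mk q, fun z hz => ?_⟩
  have hz2 : ‖z‖ < 2 * Real.pi := by linarith [Real.pi_pos]
  simp only [PowerSeries.coeff_mk]
  refine (congrArg (HasSum _) ?_).mp (hq z hz2)
  beta_reduce
  by_cases h0 : z = 0
  · subst h0
    rw [ramanujanSum_add_eq_zero, hasExpansion_coeffA.apply_zero (by positivity),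
      hasExpansion_coeffB.apply_zero (by positivity), coeffA_zero, coeffB_zero, todd_zero]
    simp [gammaFactor, toddQuot_zero]
    norm_num
  · rw [ramanujanSum_add_eq hz h0 (hasExpansion_coeffA.hasSum_succ (by simp [coeffA_zero]) hz2)
      (hasExpansion_coeffB.hasSum_succ (by simp [coeffB_zero]) hz2), gammaFactor, if_neg h0,
      entirePart_neg_one_eq_integral]
    have hpre : Complex.exp z * Complex.exp z * todd z =
        Complex.exp z / (1 - Complex.exp (-z)) * z := by
      have hez := exp_sub_one_ne_zero hz2 h0
      have hE := Complex.exp_ne_zero z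
      have hne : 1 - Complex.exp (-z) = (Complex.exp z - 1) / Complex.exp z := by
        rw [Complex.exp_neg]; field_simp
      rw [todd_of_ne h0, hne]
      field_simp
    rw [hpre]
    ring

end RamanujanSummation

theorem theorem1 :
    (∀ z : ℂ, ‖z‖ < Real.pi →
      RamanujanSummation.RamanujanSummable (RamanujanSummation.logTerm z) ∧
      RamanujanSummation.RamanujanSummable (RamanujanSummation.harmonicTerm z)) ∧
    (∃ q : PowerSeries ℚ, ∀ z : ℂ, ‖z‖ < Real.pi →
      HasSum (fun k : ℕ => ((PowerSeries.coeff k q : ℚ) : ℂ) * z ^ k)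
        (RamanujanSummation.ramanujanSum (RamanujanSummation.logTerm z)
          + Complex.exp z * RamanujanSummation.ramanujanSum (RamanujanSummation.harmonicTerm z)
          - (Real.eulerMascheroniConstant : ℂ) * RamanujanSummation.gammaFactor z)) ∧
    (∀ z : ℂ, ‖z‖ < Real.pi → z ≠ 0 →
      ∃ sA sB sC : ℂ,
        HasSum (fun k : ℕ => (RamanujanSummation.coeffA (k + 1) : ℂ) * z ^ (k + 1)) sA ∧
        HasSum (fun k : ℕ => (RamanujanSummation.coeffB (k + 1) : ℂ) * z ^ (k + 1)) sB ∧
        HasSum (fun n : ℕ => (RamanujanSummation.coeffC (n + 1) : ℂ) * z ^ (n + 1)) sC ∧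
        RamanujanSummation.ramanujanSum (RamanujanSummation.logTerm z)
            + Complex.exp z * RamanujanSummation.ramanujanSum (RamanujanSummation.harmonicTerm z)
          = (Real.eulerMascheroniConstant : ℂ)
              * (Complex.exp z / (1 - Complex.exp (-z)) - 1 / z)
            + sA + sB
            + Complex.exp z / (1 - Complex.exp (-z))
                * Complex.log (z / (1 - Complex.exp (-z)))
            + Complex.exp z / (1 - Complex.exp (-z)) * sC) := by
  refine ⟨fun z hz => ?_, RamanujanSummation.exists_rational_series, fun z hz h0 => ?_⟩
  · by_cases h0 : z = 0
    · subst h0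
      exact ⟨⟨_, RamanujanSummation.hasRamanujanSum_logTerm_zero⟩,
        ⟨_, RamanujanSummation.hasRamanujanSum_harmonicTerm_zero⟩⟩
    · exact ⟨⟨_, RamanujanSummation.hasRamanujanSum_logTerm hz h0⟩,
        ⟨_, RamanujanSummation.hasRamanujanSum_harmonicTerm hz h0⟩⟩
  · have hz2 : ‖z‖ < 2 * Real.pi := by linarith [Real.pi_pos]
    have hA := RamanujanSummation.hasExpansion_coeffA.hasSum_succ
      (by simp [RamanujanSummation.coeffA_zero]) hz2
    have hB := RamanujanSummation.hasExpansion_coeffB.hasSum_succ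
      (by simp [RamanujanSummation.coeffB_zero]) hz2
    refine ⟨_, _, _, hA, hB, RamanujanSummation.hasSum_coeffC z, ?_⟩
    rw [RamanujanSummation.ramanujanSum_add_eq hz h0 hA hB,
      RamanujanSummation.entirePart_neg_one_eq_log hz h0, mul_add, ← add_assoc]
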